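/- Consider preemptive scheduling on a single machine. An instance is a finite set $Q$ of jobs; a job $q$ has a processing time $p_q>0$, a prediction $\tilde p_q>0$, a weight $w_q>0$ and a release time $r_q\ge 0$. At each time the machine processes at most one job that is released and not yet completed, and a job is completed at the time $c_q$ at which it has been processed for a total time of $p_q$. The cost is the weighted flow time $\sum_{q} w_q(c_q-r_q)$; $\mathrm{OPT}$ is the infimum of the cost over all schedules (chosen with full knowledge of the instance), and $P=\max_q p_q/\min_q p_q$ (with $P=1$ if $Q=\emptyset$). A (deterministic) online algorithm learns $r_q,w_q,\tilde p_q$ when $q$ is released, but learns $p_q$ only when it completes $q$: what it processes at time $t$ depends only on the jobs released by time $t$, with their release times, weights and predictions, and on which jobs it has completed by time $t$ and when. There is an absolute constant $C>0$ such that for every $\mu>1$ there is an online algorithm whose cost is at most $$C\,\mu^3\,\bigl(1+\log_2(\mu P)\bigr)\cdot \mathrm{OPT}$$ on every instance with $\tilde p_q\le p_q<\mu\tilde p_q$ for all $q\in Q$. (The algorithm depends on $\mu$ but not on $P$.) Moreover, the algorithm can be chosen to obey the following rule on every instance. Put $\lambda=16\mu+6$, let $\mathrm{wc}(q)=\lceil\log_\lambda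 w_q\rceil$, so that $\lambda^{\mathrm{wc}(q)}$ is the weight $w_q$ rounded up to an integer power of $\lambda$, and let $\mathrm{idc}(q)=\lfloor\log_2(\tilde p_q/\lambda^{\mathrm{wc}(q)})\rfloor$. At every time at which some job is pending (released and not completed), let $i$ be the largest $\mathrm{wc}$ of a pending job, let $j$ be the least integer such that the pending jobs with $\mathrm{idc}=j$ have total rounded weight at least $\lambda^i$, and let $i'$ be the largest $\mathrm{wc}$ of a pending job with $\mathrm{idc}=j$; the algorithm processes a pending job with $\mathrm{wc}=i'$ and $\mathrm{idc}=j$, and it chooses one that has already been processed for a positive amount of time if there is one. -/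

import Mathlib

open MeasureTheory
open scoped ENNReal

noncomputable section

namespace SPPT

/-- A finite set of jobs, labelled by natural numbers, with real and predicted processing times,
weights and release times. Values at labels outside `jobs` are irrelevant. -/
structure Instance where
  jobs : Finset ℕ
  procTime : ℕ → ℝ
  pred : ℕ → ℝ
  weight : ℕ → ℝ
  release : ℕ → ℝ
  procTime_pos : ∀ q ∈ jobs, 0 < procTime q
  pred_pos : ∀ q ∈ jobs, 0 < pred q
  weight_pos : ∀ q ∈ jobs, 0 < weight q
  release_nonneg : ∀ q ∈ jobs, 0 ≤ release q

/-- The time spent on job `q` during `[0, t)`, if `job s` is the job on the machine at time `s`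
(`none` means that the machine is idle). -/
def processed (job : ℝ → Option ℕ) (q : ℕ) (t : ℝ) : ℝ :=
  volume.real {s : ℝ | 0 ≤ s ∧ s < t ∧ job s = some q}

namespace Instance

/-- `p̃_q ≤ p_q < μ p̃_q` for every job. -/
def DistortionBelow (I : Instance) (μ : ℝ) : Prop :=
  ∀ q ∈ I.jobs, I.pred q ≤ I.procTime q ∧ I.procTime q < μ * I.pred q

open Classical in
/-- The ratio `P` of the largest to the smallest processing time (`1` if there are no jobs). -/
def procRatio (I : Instance) : ℝ :=
  if h : I.jobs.Nonempty then I.jobs.sup' h I.procTime / I.jobs.inf' h I.procTime else 1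

/-- Job `q` is released, and not completed, at time `t`. -/
def Pending (I : Instance) (job : ℝ → Option ℕ) (q : ℕ) (t : ℝ) : Prop :=
  q ∈ I.jobs ∧ I.release q ≤ t ∧ processed job q t < I.procTime q

end Instance

/-- A preemptive schedule on a single machine. It need not complete every job. -/
structure Schedule (I : Instance) where
  job : ℝ → Option ℕ
  measurable_job : ∀ q, MeasurableSet {t : ℝ | job t = some q}
  job_pending : ∀ t q, job t = some q → I.Pending job q t

namespace Schedule

variable {I : Instance}

/-- The completion time of `q`, which is `⊤` if `q` is never completed. -/
def completionTime (σ : Schedule I) (q : ℕ) : ℝ≥0∞ :=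
  ⨅ t ∈ {t : ℝ | 0 ≤ t ∧ I.procTime q ≤ processed σ.job q t}, ENNReal.ofReal t

/-- The weighted flow time `∑ w_q (c_q - r_q)`. -/
def flowTime (σ : Schedule I) : ℝ≥0∞ :=
  ∑ q ∈ I.jobs,
    ENNReal.ofReal (I.weight q) * (σ.completionTime q - ENNReal.ofReal (I.release q))

end Schedule

/-- The optimal (offline, clairvoyant) weighted flow time. -/
def Instance.opt (I : Instance) : ℝ≥0∞ := ⨅ σ : Schedule I, σ.flowTime

/-- Two runs look the same to the scheduler up to and including time `t`: the same jobs have been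
released, with the same release times, weights and predictions, and the same jobs have been seen to
complete at the same times. The real processing times are not compared. -/
def SameView {I I' : Instance} (σ : Schedule I) (σ' : Schedule I') (t : ℝ) : Prop :=
  (∀ q, (q ∈ I.jobs ∧ I.release q ≤ t) ↔ (q ∈ I'.jobs ∧ I'.release q ≤ t)) ∧
  (∀ q ∈ I.jobs, I.release q ≤ t →
    I.release q = I'.release q ∧ I.weight q = I'.weight q ∧ I.pred q = I'.pred q) ∧
  (∀ s ≤ t, ∀ q, I.Pending σ.job q s ↔ I'.Pending σ'.job q s)

/-- A deterministic online algorithm for scheduling with predicted processing times: whenever two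
runs look the same up to time `t`, the same job is processed at time `t`. -/
structure OnlineAlgorithm where
  run : (I : Instance) → Schedule I
  causal : ∀ (I I' : Instance) (t : ℝ),
    SameView (run I) (run I') t → (run I).job t = (run I').job t

/-- `A` is `μ`-robust with competitive ratio `ρ I` on the instance `I`. -/
def OnlineAlgorithm.IsRobustCompetitive (A : OnlineAlgorithm) (μ : ℝ) (ρ : Instance → ℝ) : Prop :=
  ∀ I : Instance, I.DistortionBelow μ → (A.run I).flowTime ≤ ENNReal.ofReal (ρ I) * I.opt

/-- The base `λ` for rounding the weights. -/
def base (μ : ℝ) : ℝ := 16 * μ + 6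

/-- The weight class: `λ ^ weightClass` is the weight rounded up to a power of `λ`. -/
def Instance.weightClass (I : Instance) (μ : ℝ) (q : ℕ) : ℤ :=
  ⌈Real.logb (base μ) (I.weight q)⌉

/-- The weight rounded up to an integer power of `λ`. -/
def Instance.roundedWeight (I : Instance) (μ : ℝ) (q : ℕ) : ℝ :=
  base μ ^ I.weightClass μ q

/-- The estimated inverse density class, with respect to the rounded weight. -/
def Instance.densityClass (I : Instance) (μ : ℝ) (q : ℕ) : ℤ :=
  ⌊Real.logb 2 (I.pred q / I.roundedWeight μ q)⌋

namespace Schedule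

variable {I : Instance}

open Classical in
/-- The total rounded weight of the jobs of estimated inverse density class `j` pending at `t`. -/
def classWeight (σ : Schedule I) (μ : ℝ) (j : ℤ) (t : ℝ) : ℝ :=
  ∑ q ∈ I.jobs with I.Pending σ.job q t ∧ I.densityClass μ q = j, I.roundedWeight μ q

/-- Whenever a job is pending, the job `q` on the machine is chosen as follows. Let `i` be the
largest weight class of a pending job. The class of `q` is the least estimated inverse density class
of total rounded weight at least `λ ^ i`; among the pending jobs of this class, `q` has the largest
weight class, and within these two classes a partially processed job is preferred. -/
def FollowsDensityRule (σ : Schedule I) (μ : ℝ) : Prop :=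
  ∀ t : ℝ, (∃ q, I.Pending σ.job q t) →
    ∃ q, σ.job t = some q ∧
      ∃ i : ℤ,
        IsGreatest {k | ∃ m, I.Pending σ.job m t ∧ I.weightClass μ m = k} i ∧
        IsLeast {j | base μ ^ i ≤ σ.classWeight μ j t} (I.densityClass μ q) ∧
        IsGreatest {k | ∃ m, I.Pending σ.job m t ∧ I.densityClass μ m = I.densityClass μ q ∧
          I.weightClass μ m = k} (I.weightClass μ q) ∧
        ((∃ m, I.Pending σ.job m t ∧ I.densityClass μ m = I.densityClass μ q ∧
          I.weightClass μ m = I.weightClass μ q ∧ 0 < processed σ.job m t) →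
            0 < processed σ.job q t)

end Schedule

end SPPT

end

/-! Weighted flow time is the integral over time of the pending weight. So it suffices to compare
the rule's schedule `σ` with an arbitrary schedule `τ` at each time `t`: the rounded weight pending
in `σ` is at most O(μ²(1 + log(μP))) times that in `τ` (`pendingWeight_le`). Undoing the rounding
costs one more factor λ = O(μ).

Let W > 0 be the rounded weight pending in `τ` at `t`, and choose h with λ^(h-1) ≤ 100μW < λ^h; then
`τ` has no heavy job (weight class at least h) pending. The core is `deficit_le`: on the set S_j of
jobs that are heavy or of density class at most j, `σ` lags behind `τ` by at most 4μ 2^j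
min(λ^(h-1), p_max/2^(j+1)). The lag cannot grow after the last moment at which `σ` does not work on
S_j. Suppose that `σ` is then working on another job. If no heavy job is pending at that moment, the
rule has passed over every class k ≤ j, so each has weight below λ^i for some i < h, and the volumes
sum geometrically. If a heavy job is pending, the rule works on a class j' > j because its light
jobs weigh at least λ^h. Most of that weight is untouched: preferring started jobs leaves at most
one started job per weight class. It stays untouched until `t`, exceeding what the volume left in
`τ` and the lag on S_j' permit. Downward induction on j supplies the lag bound for j'.

Letting j tend to -∞ shows that `σ` has no heavy job pending (`weightClass_lt`). In class j, the
started jobs form a geometric series, and the untouched ones weigh at most 2^(-j) times the volume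
left in `τ` plus the lag. Summed over j, the first contribution is O(μW); the minima are O(μW) for
O(1 + log(μP)) classes and decay geometrically beyond them. -/

namespace SPPT

/-! ### Processed time as a function of time -/

section WorkDone

variable {job job' : ℝ → Option ℕ} {q : ℕ} {s t : ℝ}

theorem processed_nonneg (job : ℝ → Option ℕ) (q : ℕ) (t : ℝ) : 0 ≤ processed job q t :=
  measureReal_nonneg

theorem processed_congr (h : ∀ s, 0 ≤ s → s < t → job s = job' s) :
    processed job q t = processed job' q t := by
  unfold processed
  congr 1
  ext s
  constructor
  · rintro ⟨h0, h1, h2⟩; exact ⟨h0, h1, (h s h0 h1) ▸ h2⟩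
  · rintro ⟨h0, h1, h2⟩; exact ⟨h0, h1, (h s h0 h1).symm ▸ h2⟩

theorem processed_eq_zero (h : ∀ s, 0 ≤ s → s < t → job s ≠ some q) : processed job q t = 0 := by
  have : {s : ℝ | 0 ≤ s ∧ s < t ∧ job s = some q} = ∅ := by
    ext s
    simp only [Set.mem_ofPred_eq, Set.mem_empty_iff_false, iff_false]
    rintro ⟨h0, h1, h2⟩
    exact h s h0 h1 h2
  simp [processed, this]

theorem processed_of_nonpos (ht : t ≤ 0) : processed job q t = 0 :=
  processed_eq_zero fun _ h0 h1 => absurd (h0.trans_lt h1) ht.not_gt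

theorem processed_mono (job : ℝ → Option ℕ) (q : ℕ) : Monotone (processed job q) := by
  intro s t hst
  refine measureReal_mono (fun u hu => ⟨hu.1, hu.2.1.trans_le hst, hu.2.2⟩) ?_
  have : {u : ℝ | 0 ≤ u ∧ u < t ∧ job u = some q} ⊆ Set.Ico 0 t := fun u hu => ⟨hu.1, hu.2.1⟩
  exact ((measure_mono this).trans_lt (by simp)).ne

theorem processed_sub (hm : MeasurableSet {u | job u = some q}) (hs : 0 ≤ s) (hst : s ≤ t) :
    processed job q t - processed job q s =
      volume.real (Set.Ico s t ∩ {u | job u = some q}) := by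
  have hU : {u : ℝ | 0 ≤ u ∧ u < t ∧ job u = some q} =
      {u : ℝ | 0 ≤ u ∧ u < s ∧ job u = some q} ∪ (Set.Ico s t ∩ {u | job u = some q}) := by
    ext u
    simp only [Set.mem_ofPred_eq, Set.mem_union, Set.mem_inter_iff, Set.mem_Ico]
    constructor
    · rintro ⟨h0, h1, h2⟩
      rcases lt_or_ge u s with h | h
      · exact Or.inl ⟨h0, h, h2⟩
      · exact Or.inr ⟨⟨h, h1⟩, h2⟩
    · rintro (⟨h0, h1, h2⟩ | ⟨⟨h0, h1⟩, h2⟩)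
      · exact ⟨h0, h1.trans_le hst, h2⟩
      · exact ⟨hs.trans h0, h1, h2⟩
  unfold processed
  have hsub : {u : ℝ | 0 ≤ u ∧ u < s ∧ job u = some q} ⊆ Set.Ico 0 s := fun u hu => ⟨hu.1, hu.2.1⟩
  rw [hU, measureReal_union _ (measurableSet_Ico.inter hm)
    ((measure_mono hsub).trans_lt (by simp)).ne
    ((measure_mono Set.inter_subset_left).trans_lt (by simp)).ne]
  · ring
  · rw [Set.disjoint_left]
    rintro u ⟨_, h1, _⟩ ⟨⟨h2, _⟩, _⟩
    exact absurd h1 h2.not_gt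

theorem sum_processed_sub (hm : ∀ q, MeasurableSet {u | job u = some q}) (S : Finset ℕ)
    (hs : 0 ≤ s) (hst : s ≤ t) :
    ∑ q ∈ S, (processed job q t - processed job q s) =
      volume.real (Set.Ico s t ∩ {u | ∃ q ∈ S, job u = some q}) := by
  rw [Finset.sum_congr rfl fun q _ => processed_sub (hm q) hs hst,
    ← measureReal_biUnion_finset _ (fun q _ => measurableSet_Ico.inter (hm q))
      (fun q _ => ((measure_mono Set.inter_subset_left).trans_lt (by simp)).ne)]
  · congr 1
    ext u
    simp only [Set.mem_iUnion, Set.mem_inter_iff, Set.mem_ofPred_eq]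
    tauto
  · intro a _ b _ hab
    rw [Function.onFun, Set.disjoint_left]
    rintro u ⟨_, h1⟩ ⟨_, h2⟩
    exact hab (Option.some_injective _ (h1.symm.trans h2))

theorem sum_processed_sub_le (hm : ∀ q, MeasurableSet {u | job u = some q}) (S : Finset ℕ)
    (hs : 0 ≤ s) (hst : s ≤ t) :
    ∑ q ∈ S, (processed job q t - processed job q s) ≤ t - s := by
  rw [sum_processed_sub hm S hs hst]
  refine (measureReal_mono Set.inter_subset_left (by simp)).trans ?_
  simp [hst]

theorem le_sum_processed_sub (hm : ∀ q, MeasurableSet {u | job u = some q}) {S : Finset ℕ}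
    (hs : 0 ≤ s) (hst : s ≤ t) (h : ∀ u, s < u → u < t → ∃ q ∈ S, job u = some q) :
    t - s ≤ ∑ q ∈ S, (processed job q t - processed job q s) := by
  rw [sum_processed_sub hm S hs hst]
  have : volume.real (Set.Ioo s t) = t - s := by simp [hst]
  rw [← this]
  refine measureReal_mono (fun u hu => ⟨⟨hu.1.le, hu.2⟩, h u hu.1 hu.2⟩) ?_
  exact ((measure_mono Set.inter_subset_left).trans_lt (by simp)).ne

theorem processed_eq_of_forall_ne (hm : MeasurableSet {u | job u = some q}) (hs : 0 ≤ s)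
    (hst : s ≤ t) (h : ∀ u, s < u → u < t → job u ≠ some q) :
    processed job q t = processed job q s := by
  have h1 := processed_sub hm hs hst
  have h2 : volume.real (Set.Ico s t ∩ {u | job u = some q}) ≤ volume.real ({s} : Set ℝ) := by
    refine measureReal_mono ?_ (by simp)
    rintro u ⟨⟨h1, h2⟩, h3⟩
    rcases h1.eq_or_lt with h4 | h4
    · exact h4.symm
    · exact absurd h3 (h u h4 h2)
  have h3 : volume.real ({s} : Set ℝ) = 0 := by simp [Measure.real]
  have := processed_mono job q hst
  linarith

theorem processed_le_add (hm : MeasurableSet {u | job u = some q}) (hst : s ≤ t) :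
    processed job q t ≤ processed job q s + (t - s) := by
  have key : ∀ s t : ℝ, 0 ≤ s → s ≤ t → processed job q t ≤ processed job q s + (t - s) := by
    intro s t hs hst
    have h1 := processed_sub hm hs hst
    have h2 : volume.real (Set.Ico s t ∩ {u | job u = some q}) ≤ volume.real (Set.Ico s t) :=
      measureReal_mono Set.inter_subset_left (by simp)
    have h3 : volume.real (Set.Ico s t) = t - s := by simp [hst]
    linarith
  rcases le_total 0 s with hs | hs
  · exact key s t hs hst
  · rcases le_total 0 t with ht | ht
    · have := key 0 t le_rfl ht
      rw [processed_of_nonpos le_rfl] at this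
      rw [processed_of_nonpos hs]
      linarith
    · rw [processed_of_nonpos hs, processed_of_nonpos ht]
      linarith

theorem continuous_processed (hm : MeasurableSet {u | job u = some q}) :
    Continuous (processed job q) := by
  refine (LipschitzWith.of_le_add fun x y => ?_).continuous (K := 1)
  rcases le_total x y with h | h
  · exact (processed_mono job q h).trans (le_add_of_nonneg_right dist_nonneg)
  · have := processed_le_add hm h
    rwa [Real.dist_eq, abs_of_nonneg (sub_nonneg.2 h)]

end WorkDone

namespace Schedule

variable {I : Instance} (σ : Schedule I)

theorem processed_of_le_release {q : ℕ} {t : ℝ} (h : t ≤ I.release q) :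
    processed σ.job q t = 0 :=
  processed_eq_zero fun s _ hs hq => absurd (σ.job_pending s q hq).2.1 (hs.trans_le h).not_ge

theorem processed_le {q : ℕ} (hq : q ∈ I.jobs) (t : ℝ) : processed σ.job q t ≤ I.procTime q := by
  by_contra! hlt
  have hpos := I.procTime_pos q hq
  have ht : 0 ≤ t := by
    by_contra! h
    rw [processed_of_nonpos h.le] at hlt
    linarith
  -- By continuity the processed time equals `procTime` at some moment `u`; from then on the job is
  -- not pending and cannot run.
  obtain ⟨u, ⟨hu0, hut⟩, hu⟩ := intermediate_value_Icc ht
    (continuous_processed (σ.measurable_job q)).continuousOn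
    ⟨by rw [processed_of_nonpos le_rfl]; exact hpos.le, hlt.le⟩
  have := processed_eq_of_forall_ne (σ.measurable_job q) hu0 hut fun v hv _ hj =>
    absurd (σ.job_pending v q hj).2.2 (hu.symm.le.trans (processed_mono _ _ hv.le)).not_gt
  linarith

end Schedule

/-- The density rule for a set `P` of pending jobs with weight classes `wc` and density classes
`dc`, where `T` is the set of jobs that have been processed. -/
def Eligible (b : ℝ) (wc dc : ℕ → ℤ) (P : Finset ℕ) (T : Set ℕ) (q : ℕ) : Prop :=
  q ∈ P ∧ ∃ i : ℤ,
    IsGreatest {k | ∃ m, m ∈ P ∧ wc m = k} i ∧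
    IsLeast {j | b ^ i ≤ ∑ m ∈ P with dc m = j, b ^ wc m} (dc q) ∧
    IsGreatest {k | ∃ m, m ∈ P ∧ dc m = dc q ∧ wc m = k} (wc q) ∧
    ((∃ m, m ∈ P ∧ dc m = dc q ∧ wc m = wc q ∧ m ∈ T) → q ∈ T)

/-! ### The selection rule as a function of the pending and the started jobs -/

section Eligible

variable {b : ℝ} {wc dc wc' dc' : ℕ → ℤ} {P : Finset ℕ} {T T' : Set ℕ} {q q' : ℕ}

theorem exists_isGreatest_image (f : ℕ → ℤ) (p : ℕ → Prop) (h : ∃ m ∈ P, p m) :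
    ∃ m ∈ P, p m ∧ IsGreatest {k | ∃ m, m ∈ P ∧ p m ∧ f m = k} (f m) := by
  classical
  obtain ⟨m, hm, hmax⟩ := (P.filter p).exists_max_image f
    (by obtain ⟨m, hm, hp⟩ := h; exact ⟨m, Finset.mem_filter.2 ⟨hm, hp⟩⟩)
  rw [Finset.mem_filter] at hm
  refine ⟨m, hm.1, hm.2, ⟨m, hm.1, hm.2, rfl⟩, ?_⟩
  rintro k ⟨m', h1, h2, rfl⟩
  exact hmax m' (Finset.mem_filter.2 ⟨h1, h2⟩)

theorem exists_eligible (hb : 0 < b) (hP : P.Nonempty) : ∃ q, Eligible b wc dc P T q := by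
  classical
  obtain ⟨q₀, hq₀, hmax⟩ := P.exists_max_image wc hP
  set i := wc q₀
  have hj : ∃ j ∈ P.image dc, b ^ i ≤ ∑ m ∈ P with dc m = j, b ^ wc m := by
    refine ⟨dc q₀, Finset.mem_image_of_mem _ hq₀, ?_⟩
    exact Finset.single_le_sum (f := fun m => b ^ wc m) (fun m _ => (zpow_pos hb _).le)
      (Finset.mem_filter.2 ⟨hq₀, rfl⟩)
  obtain ⟨j, hj, hmin⟩ := ((P.image dc).filter fun j => b ^ i ≤ ∑ m ∈ P with dc m = j,
    b ^ wc m).exists_min_image id (by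
      obtain ⟨j, h1, h2⟩ := hj
      exact ⟨j, Finset.mem_filter.2 ⟨h1, h2⟩⟩)
  rw [Finset.mem_filter, Finset.mem_image] at hj
  obtain ⟨⟨q₁, hq₁, rfl⟩, hw⟩ := hj
  obtain ⟨q₂, hq₂, hd, hg⟩ := exists_isGreatest_image wc (fun m => dc m = dc q₁) ⟨q₁, hq₁, rfl⟩
  obtain ⟨q, hq, hdq, hwq, ht⟩ : ∃ q ∈ P, dc q = dc q₁ ∧ wc q = wc q₂ ∧
      ((∃ m, m ∈ P ∧ dc m = dc q₁ ∧ wc m = wc q₂ ∧ m ∈ T) → q ∈ T) := by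
    by_cases h : ∃ m, m ∈ P ∧ dc m = dc q₁ ∧ wc m = wc q₂ ∧ m ∈ T
    · obtain ⟨m, h1, h2, h3, h4⟩ := h
      exact ⟨m, h1, h2, h3, fun _ => h4⟩
    · exact ⟨q₂, hq₂, hd, rfl, fun h' => absurd h' h⟩
  refine ⟨q, hq, i, ⟨⟨q₀, hq₀, rfl⟩, ?_⟩, ⟨?_, ?_⟩, ?_, ?_⟩
  · rintro k ⟨m, hm, rfl⟩
    exact hmax m hm
  · rw [Set.mem_ofPred_eq, hdq]
    exact hw
  · intro j hj
    rw [hdq]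
    have hne : (P.filter fun m => dc m = j).Nonempty := by
      by_contra hne
      rw [Finset.not_nonempty_iff_eq_empty] at hne
      rw [Set.mem_ofPred_eq, hne, Finset.sum_empty] at hj
      exact absurd (zpow_pos hb i) hj.not_gt
    obtain ⟨m, hm⟩ := hne
    rw [Finset.mem_filter] at hm
    exact hmin j (Finset.mem_filter.2 ⟨Finset.mem_image.2 ⟨m, hm⟩, hj⟩)
  · rw [hdq, hwq]; exact hg
  · rw [hdq, hwq]; exact ht

theorem Eligible.congr (hw : ∀ m ∈ P, wc m = wc' m) (hd : ∀ m ∈ P, dc m = dc' m)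
    (hT : ∀ m ∈ P, m ∈ T → m ∈ T') (hT' : ∀ m ∈ P, m ∈ T' → m ∈ T)
    (h : Eligible b wc dc P T q) : Eligible b wc' dc' P T' q := by
  obtain ⟨hq, i, hi, hj, hk, ht⟩ := h
  have e : ∀ j, ∑ m ∈ P with dc m = j, b ^ wc m = ∑ m ∈ P with dc' m = j, b ^ wc' m := by
    intro j
    refine Finset.sum_congr (Finset.filter_congr fun m hm => by rw [hd m hm]) fun m hm => ?_
    rw [hw m (Finset.mem_filter.1 hm).1]
  refine ⟨hq, i, ?_, ?_, ?_, ?_⟩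
  · convert hi using 3 with k
    refine exists_congr fun m => and_congr_right fun hm => by rw [hw m hm]
  · rw [← hd q hq]
    simpa only [e] using hj
  · rw [← hd q hq, ← hw q hq]
    convert hk using 3 with k
    refine exists_congr fun m => and_congr_right fun hm => by rw [hw m hm, hd m hm]
  · rintro ⟨m, h1, h2, h3, h4⟩
    exact hT q hq (ht ⟨m, h1, by rw [hd m h1, hd q hq, h2], by rw [hw m h1, hw q hq, h3],
      hT' m h1 h4⟩)

theorem Eligible.class_eq (h : Eligible b wc dc P T q) (h' : Eligible b wc dc P T' q') :
    dc q = dc q' ∧ wc q = wc q' := by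
  obtain ⟨_, i, hi, hj, hk, _⟩ := h
  obtain ⟨_, i', hi', hj', hk', _⟩ := h'
  obtain rfl := hi.unique hi'
  have hd := hj.unique hj'
  rw [hd] at hk
  exact ⟨hd, hk.unique hk'⟩

open Classical in
/-- The eligible job with the smallest label. -/
noncomputable def pick (b : ℝ) (wc dc : ℕ → ℤ) (P : Finset ℕ) (T : Set ℕ) : Option ℕ :=
  if h : ∃ q, Eligible b wc dc P T q then some (Nat.find h) else none

theorem eligible_of_pick (h : pick b wc dc P T = some q) : Eligible b wc dc P T q := by
  classical
  unfold pick at h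
  split_ifs at h with hex
  rw [← Option.some_injective _ h]
  exact Nat.find_spec hex

theorem pick_eq_some (h : Eligible b wc dc P T q)
    (hmin : ∀ m, Eligible b wc dc P T m → q ≤ m) : pick b wc dc P T = some q := by
  classical
  unfold pick
  rw [dif_pos ⟨q, h⟩]
  congr 1
  exact le_antisymm (Nat.find_min' _ h) (hmin _ (Nat.find_spec ⟨q, h⟩))

theorem le_of_pick (h : pick b wc dc P T = some q) (hq' : Eligible b wc dc P T q') : q ≤ q' := by
  classical
  unfold pick at h
  rw [dif_pos ⟨q', hq'⟩] at h
  rw [← Option.some_injective _ h]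
  exact Nat.find_min' _ hq'

theorem pick_congr (hw : ∀ m ∈ P, wc m = wc' m) (hd : ∀ m ∈ P, dc m = dc' m)
    (hT : ∀ m ∈ P, m ∈ T ↔ m ∈ T') : pick b wc dc P T = pick b wc' dc' P T' := by
  have : ∀ q, Eligible b wc dc P T q ↔ Eligible b wc' dc' P T' q := fun q =>
    ⟨Eligible.congr hw hd (fun m hm => (hT m hm).1) (fun m hm => (hT m hm).2),
      Eligible.congr (fun m hm => (hw m hm).symm) (fun m hm => (hd m hm).symm)
        (fun m hm => (hT m hm).2) (fun m hm => (hT m hm).1)⟩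
  exact Option.ext fun q =>
    ⟨fun h => pick_eq_some ((this q).1 (eligible_of_pick h)) fun m hm =>
        le_of_pick h ((this m).2 hm),
      fun h => pick_eq_some ((this q).2 (eligible_of_pick h)) fun m hm =>
        le_of_pick h ((this m).1 hm)⟩

theorem pick_eq_none (hb : 0 < b) : pick b wc dc P T = none ↔ P = ∅ := by
  constructor
  · intro h
    by_contra hP
    unfold pick at h
    rw [dif_pos (exists_eligible hb (Finset.nonempty_iff_ne_empty.2 hP))] at h
    cases h
  · rintro rfl
    unfold pick
    rw [dif_neg]
    rintro ⟨q, hq, _⟩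
    simp at hq

/-- Running the selected job only marks it as started. This can only shrink the set of eligible
jobs, and the selected one remains in it, so the tie-break by label still finds it. Hence the rule
does not switch jobs between events. -/
theorem pick_insert (h : pick b wc dc P T = some q)
    (hT : ∀ m ∈ P, m ∈ T' ↔ m ∈ T ∨ m = q) : pick b wc dc P T' = some q := by
  have hq := eligible_of_pick h
  have hqT : q ∈ T' := (hT q hq.1).2 (Or.inr rfl)
  refine pick_eq_some ?_ fun m hm => ?_
  · obtain ⟨h1, i, h2, h3, h4, _⟩ := hq
    exact ⟨h1, i, h2, h3, h4, fun _ => hqT⟩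
  · obtain ⟨hd, hw⟩ := hq.class_eq hm
    obtain ⟨h1, i, h2, h3, h4, h5⟩ := hm
    have hmT := h5 ⟨q, hq.1, hd, hw, hqT⟩
    rcases (hT m h1).1 hmT with h6 | h6
    · exact le_of_pick h ⟨h1, i, h2, h3, h4, fun _ => h6⟩
    · exact h6.ge

end Eligible

theorem base_pos {μ : ℝ} (hμ : 1 < μ) : 0 < base μ := by unfold base; linarith

open Classical in
/-- The jobs pending at time `t`. -/
noncomputable def Instance.pendingSet (I : Instance) (job : ℝ → Option ℕ) (t : ℝ) : Finset ℕ :=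
  I.jobs.filter fun q => I.Pending job q t

theorem Instance.mem_pendingSet {I : Instance} {job : ℝ → Option ℕ} {t : ℝ} {q : ℕ} :
    q ∈ I.pendingSet job t ↔ I.Pending job q t := by
  simp only [pendingSet, Finset.mem_filter, and_iff_right_iff_imp]
  exact fun h => h.1

/-- The job to be processed at time `t`, given what was processed before `t`. -/
noncomputable def Instance.ruleJob (I : Instance) (μ : ℝ) (job : ℝ → Option ℕ) (t : ℝ) :
    Option ℕ :=
  pick (base μ) (I.weightClass μ) (I.densityClass μ) (I.pendingSet job t)
    {q | 0 < processed job q t}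

/-- `job` is locally constant to the right of every time. -/
def RightConstant (job : ℝ → Option ℕ) : Prop :=
  ∀ t, ∃ ε > 0, ∀ s, t ≤ s → s < t + ε → job s = job t

/-! ### Construction of the run from event to event -/

section Construction

variable {I : Instance} {μ : ℝ} {job job' : ℝ → Option ℕ} {t T : ℝ}

theorem pending_congr (h : ∀ s, s < t → job s = job' s) (q : ℕ) :
    I.Pending job q t ↔ I.Pending job' q t := by
  unfold Instance.Pending
  rw [processed_congr fun s _ hs => h s hs]

theorem ruleJob_congr (h : ∀ s, s < t → job s = job' s) :
    I.ruleJob μ job t = I.ruleJob μ job' t := by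
  unfold Instance.ruleJob
  have : I.pendingSet job t = I.pendingSet job' t := by
    ext q
    rw [Instance.mem_pendingSet, Instance.mem_pendingSet, pending_congr h]
  rw [this]
  congr 1
  ext q
  rw [Set.mem_ofPred_eq, Set.mem_ofPred_eq, processed_congr fun s _ hs => h s hs]

/-- `job` follows the rule before time `T`, and is idle from `T` on. -/
structure IsRunUntil (I : Instance) (μ : ℝ) (job : ℝ → Option ℕ) (T : ℝ) : Prop where
  measurable : ∀ q, MeasurableSet {t | job t = some q}
  rightConstant : RightConstant job
  rule : ∀ t < T, job t = I.ruleJob μ job t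
  idle : ∀ t, T ≤ t → job t = none

open Classical in
/-- The number of release and completion events still to come at time `T`. -/
noncomputable def eventsLeft (I : Instance) (job : ℝ → Option ℕ) (T : ℝ) : ℕ :=
  (I.jobs.filter fun q => T < I.release q).card +
    (I.jobs.filter fun q => processed job q T < I.procTime q).card

open Classical in
/-- `job`, changed to `o` on `[T, T')`. -/
noncomputable def extendJob (job : ℝ → Option ℕ) (T T' : ℝ) (o : Option ℕ) : ℝ → Option ℕ :=
  fun t => if T ≤ t ∧ t < T' then o else job t

variable {T' : ℝ} {o : Option ℕ}

theorem extendJob_of_mem (h : T ≤ t) (h' : t < T') : extendJob job T T' o t = o :=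
  if_pos ⟨h, h'⟩

theorem extendJob_of_lt (h : t < T) : extendJob job T T' o t = job t :=
  if_neg fun h' => absurd h h'.1.not_gt

theorem extendJob_of_ge (h : T' ≤ t) : extendJob job T T' o t = job t :=
  if_neg fun h' => absurd h h'.2.not_ge

theorem measurable_extendJob (hm : ∀ q, MeasurableSet {t | job t = some q}) (q : ℕ) :
    MeasurableSet {t | extendJob job T T' o t = some q} := by
  have : {t | extendJob job T T' o t = some q} =
      (Set.Ico T T' ∩ {_t | o = some q}) ∪ ((Set.Ico T T')ᶜ ∩ {t | job t = some q}) := by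
    ext t
    by_cases h : T ≤ t ∧ t < T'
    · simp [extendJob_of_mem h.1 h.2, h.1, h.2]
    · have : extendJob job T T' o t = job t := if_neg h
      simp only [Set.mem_ofPred_eq, this, Set.mem_union, Set.mem_inter_iff, Set.mem_Ico,
        Set.mem_compl_iff, h, false_and, false_or, not_false_eq_true, true_and]
  rw [this]
  exact (measurableSet_Ico.inter (MeasurableSet.const _)).union
    (measurableSet_Ico.compl.inter (hm q))

theorem rightConstant_extendJob (h : RightConstant job) :
    RightConstant (extendJob job T T' o) := by
  intro t
  rcases lt_or_ge t T with h1 | h1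
  · obtain ⟨ε, hε, hj⟩ := h t
    refine ⟨min ε (T - t), lt_min hε (sub_pos.2 h1), fun s hs hs' => ?_⟩
    have h2 := min_le_left ε (T - t)
    have h3 := min_le_right ε (T - t)
    rw [extendJob_of_lt h1, extendJob_of_lt (by linarith), hj s hs (by linarith)]
  · rcases lt_or_ge t T' with h2 | h2
    · refine ⟨T' - t, sub_pos.2 h2, fun s hs hs' => ?_⟩
      rw [extendJob_of_mem h1 h2, extendJob_of_mem (h1.trans hs) (by linarith)]
    · obtain ⟨ε, hε, hj⟩ := h t
      refine ⟨ε, hε, fun s hs hs' => ?_⟩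
      rw [extendJob_of_ge h2, extendJob_of_ge (h2.trans hs), hj s hs hs']

theorem processed_extendJob (hm : ∀ q, MeasurableSet {t | job t = some q}) (hT : 0 ≤ T)
    (h1 : T ≤ t) (h2 : t ≤ T') (q : ℕ) :
    processed (extendJob job T T' o) q t =
      processed job q T + if o = some q then t - T else 0 := by
  have hT' : processed (extendJob job T T' o) q T = processed job q T :=
    processed_congr fun s _ hs => extendJob_of_lt hs
  have hm' := measurable_extendJob (T := T) (T' := T') (o := o) hm
  rw [← hT']
  split_ifs with ho
  · refine le_antisymm (processed_le_add (hm' q) h1) ?_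
    have := le_sum_processed_sub hm' (S := {q}) hT h1 fun u hu hu' =>
      ⟨q, by simp, by rw [extendJob_of_mem hu.le (hu'.trans_le h2), ho]⟩
    rw [Finset.sum_singleton] at this
    linarith
  · rw [add_zero]
    refine processed_eq_of_forall_ne (hm' q) hT h1 fun u hu hu' => ?_
    rwa [extendJob_of_mem hu.le (hu'.trans_le h2)]

theorem pick_pending {q : ℕ} (h : I.ruleJob μ job t = some q) : I.Pending job q t :=
  Instance.mem_pendingSet.1 (eligible_of_pick h).1

/-- Between two events the rule keeps selecting the same job. -/
theorem ruleJob_extendJob (hμ : 1 < μ) (hm : ∀ q, MeasurableSet {t | job t = some q})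
    (hT : 0 ≤ T) (ho : I.ruleJob μ job T = o) (h1 : T ≤ t) (h2 : t < T')
    (hrel : ∀ q ∈ I.jobs, T < I.release q → T' ≤ I.release q)
    (hcomp : ∀ q, o = some q → T' ≤ T + (I.procTime q - processed job q T)) :
    I.ruleJob μ (extendJob job T T' o) t = o := by
  have hp := fun q => processed_extendJob (job := job) (o := o) hm hT h1 h2.le q
  have hpend : I.pendingSet (extendJob job T T' o) t = I.pendingSet job T := by
    ext q
    rw [Instance.mem_pendingSet, Instance.mem_pendingSet]
    unfold Instance.Pending
    rw [hp]
    refine and_congr_right fun hq => and_congr ⟨fun h => ?_, fun h => h.trans h1⟩ ?_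
    · by_contra! h3
      exact absurd (hrel q hq h3) (h.trans_lt h2).not_ge
    · split_ifs with hoq
      · have := hcomp q hoq
        constructor <;> intro <;> linarith
      · rw [add_zero]
  unfold Instance.ruleJob at ho ⊢
  rw [hpend]
  cases o with
  | none =>
    rw [pick_eq_none (base_pos hμ)] at ho ⊢
    exact ho
  | some q =>
    rcases h1.eq_or_lt with rfl | h1
    · refine (pick_congr (fun _ _ => rfl) (fun _ _ => rfl) fun m _ => ?_).trans ho
      rw [Set.mem_ofPred_eq, Set.mem_ofPred_eq, hp, sub_self, ite_self, add_zero]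
    · refine pick_insert ho fun m _ => ?_
      rw [Set.mem_ofPred_eq, Set.mem_ofPred_eq, hp]
      have h0 := processed_nonneg job m T
      split_ifs with hqm
      · have : q = m := Option.some_injective _ hqm
        simp only [this, or_true, iff_true]
        linarith
      · have : m ≠ q := fun h => hqm (by rw [h])
        simp [this]

/-- The selection is constant until the next release or the completion of the selected job, so a run
can be prolonged to that event. Finitely many events remain, which makes `eventsLeft` the
termination measure. -/
theorem IsRunUntil.exists_extension (hμ : 1 < μ) (h : IsRunUntil I μ job T) (hT : 0 ≤ T) :
    (∀ t, job t = I.ruleJob μ job t) ∨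
      ∃ job' T', 0 ≤ T' ∧ IsRunUntil I μ job' T' ∧ eventsLeft I job' T' < eventsLeft I job T := by
  classical
  set o := I.ruleJob μ job T with ho
  set F : Finset ℝ := (I.jobs.filter fun q => T < I.release q).image I.release ∪
    (I.jobs.filter fun q => o = some q).image fun q => T + (I.procTime q - processed job q T)
    with hF
  have hext : ∀ T', (∀ q ∈ I.jobs, T < I.release q → T' ≤ I.release q) →
      (∀ q, o = some q → T' ≤ T + (I.procTime q - processed job q T)) →
      ∀ t, t < T' → extendJob job T T' o t = I.ruleJob μ (extendJob job T T' o) t := by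
    intro T' hrel hcomp t ht
    rcases lt_or_ge t T with h1 | h1
    · rw [extendJob_of_lt h1, h.rule t h1]
      exact ruleJob_congr fun s hs => (extendJob_of_lt (hs.trans h1)).symm
    · rw [extendJob_of_mem h1 ht, ruleJob_extendJob hμ h.measurable hT ho.symm h1 ht hrel hcomp]
  rcases F.eq_empty_or_nonempty with hFe | hFn
  · left
    have hnr : ∀ q ∈ I.jobs, ¬ T < I.release q := fun q hq hlt => by
      have : I.release q ∈ F := Finset.mem_union_left _
        (Finset.mem_image_of_mem _ (Finset.mem_filter.2 ⟨hq, hlt⟩))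
      rw [hFe] at this
      simp at this
    have hon : o = none := by
      rcases hoq : o with _ | q
      · rfl
      · have hq := (pick_pending (ho ▸ hoq)).1
        have : T + (I.procTime q - processed job q T) ∈ F := Finset.mem_union_right _
          (Finset.mem_image.2 ⟨q, Finset.mem_filter.2 ⟨hq, hoq⟩, rfl⟩)
        rw [hFe] at this
        simp at this
    intro t
    have he : extendJob job T (max t T + 1) o = job := by
      funext s
      by_cases hs : T ≤ s ∧ s < max t T + 1
      · rw [extendJob_of_mem hs.1 hs.2, hon, h.idle s hs.1]
      · exact if_neg hs
    have := hext (max t T + 1) (fun q hq hlt => absurd hlt (hnr q hq))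
      (fun q hq => by rw [hon] at hq; cases hq) t (by linarith [le_max_left t T])
    rwa [he] at this
  · right
    set T' := F.min' hFn with hT'
    have hlt : T < T' := by
      rw [hT', Finset.lt_min'_iff]
      intro x hx
      rw [hF, Finset.mem_union, Finset.mem_image, Finset.mem_image] at hx
      rcases hx with ⟨q, hq, rfl⟩ | ⟨q, hq, rfl⟩
      · exact (Finset.mem_filter.1 hq).2
      · have := (pick_pending (ho ▸ (Finset.mem_filter.1 hq).2)).2.2
        linarith
    have hrel : ∀ q ∈ I.jobs, T < I.release q → T' ≤ I.release q := fun q hq hlt =>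
      Finset.min'_le _ _ (Finset.mem_union_left _
        (Finset.mem_image_of_mem _ (Finset.mem_filter.2 ⟨hq, hlt⟩)))
    have hcomp : ∀ q, o = some q → T' ≤ T + (I.procTime q - processed job q T) := fun q hq =>
      Finset.min'_le _ _ (Finset.mem_union_right _ (Finset.mem_image.2
        ⟨q, Finset.mem_filter.2 ⟨(pick_pending (ho ▸ hq)).1, hq⟩, rfl⟩))
    refine ⟨extendJob job T T' o, T', hT.trans hlt.le, ⟨measurable_extendJob h.measurable,
      rightConstant_extendJob h.rightConstant, hext T' hrel hcomp, fun t ht => ?_⟩, ?_⟩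
    · rw [extendJob_of_ge ht, h.idle t (hlt.le.trans ht)]
    have hp := fun q => processed_extendJob (job := job) (o := o) h.measurable hT hlt.le le_rfl q
    have hsub₁ : (I.jobs.filter fun q => T' < I.release q) ⊆
        I.jobs.filter fun q => T < I.release q :=
      Finset.monotone_filter_right _ fun q _ hq => hlt.trans hq
    have hsub₂ : (I.jobs.filter fun q => processed (extendJob job T T' o) q T' < I.procTime q) ⊆
        I.jobs.filter fun q => processed job q T < I.procTime q := by
      refine Finset.monotone_filter_right _ fun q _ hq => ?_
      rw [hp] at hq
      split_ifs at hq <;> linarith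
    have hmem := F.min'_mem hFn
    rw [← hT', hF, Finset.mem_union, Finset.mem_image, Finset.mem_image] at hmem
    unfold eventsLeft
    rcases hmem with ⟨q, hq, hqT⟩ | ⟨q, hq, hqT⟩
    · refine add_lt_add_of_lt_of_le (Finset.card_lt_card ?_) (Finset.card_le_card hsub₂)
      refine hsub₁.ssubset_of_mem_notMem hq fun h' => ?_
      exact absurd (Finset.mem_filter.1 h').2 hqT.le.not_gt
    · refine add_lt_add_of_le_of_lt (Finset.card_le_card hsub₁) (Finset.card_lt_card ?_)
      rw [Finset.mem_filter] at hq
      refine hsub₂.ssubset_of_mem_notMem (a := q)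
        (Finset.mem_filter.2 ⟨hq.1, (pick_pending (ho ▸ hq.2)).2.2⟩) fun h' => ?_
      have := (Finset.mem_filter.1 h').2
      rw [hp, if_pos hq.2] at this
      linarith

theorem exists_run (I : Instance) (hμ : 1 < μ) :
    ∃ job : ℝ → Option ℕ, (∀ q, MeasurableSet {t | job t = some q}) ∧ RightConstant job ∧
      ∀ t, job t = I.ruleJob μ job t := by
  have key : ∀ n : ℕ, ∀ job T, eventsLeft I job T = n → 0 ≤ T → IsRunUntil I μ job T →
      ∃ job : ℝ → Option ℕ, (∀ q, MeasurableSet {t | job t = some q}) ∧ RightConstant job ∧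
        ∀ t, job t = I.ruleJob μ job t := by
    intro n
    induction n using Nat.strong_induction_on with
    | _ n ih =>
      intro job T hn hT h
      rcases h.exists_extension hμ hT with h' | ⟨job', T', hT', h', hlt⟩
      · exact ⟨job, h.measurable, h.rightConstant, h'⟩
      · exact ih _ (hn ▸ hlt) job' T' rfl hT' h'
  refine key _ (fun _ => none) 0 rfl le_rfl ⟨fun q => by simp, fun t => ⟨1, one_pos, by simp⟩,
    fun t ht => ?_, fun _ _ => rfl⟩
  refine ((pick_eq_none (base_pos hμ)).2 ?_).symm
  rw [Finset.eq_empty_iff_forall_notMem]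
  intro q hq
  rw [Instance.mem_pendingSet] at hq
  exact absurd (I.release_nonneg q hq.1) (hq.2.1.trans_lt ht).not_ge

end Construction

/-- A run of the density rule with ties broken by labels. -/
structure Schedule.IsRuleRun {I : Instance} (σ : Schedule I) (μ : ℝ) : Prop where
  rightConstant : RightConstant σ.job
  rule : ∀ t, σ.job t = I.ruleJob μ σ.job t

theorem exists_isRuleRun (I : Instance) {μ : ℝ} (hμ : 1 < μ) :
    ∃ σ : Schedule I, σ.IsRuleRun μ := by
  obtain ⟨job, hm, hc, hr⟩ := exists_run I hμ
  exact ⟨⟨job, hm, fun t q h => pick_pending (μ := μ) (hr t ▸ h)⟩, hc, hr⟩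

/-! ### Causality, and uniqueness of the started job in each class -/

namespace Schedule.IsRuleRun

variable {I I' : Instance} {σ : Schedule I} {σ' : Schedule I'} {μ : ℝ}

theorem followsDensityRule (h : σ.IsRuleRun μ) (hμ : 1 < μ) : σ.FollowsDensityRule μ := by
  classical
  rintro t ⟨q₀, hq₀⟩
  have hne : σ.job t ≠ none := by
    rw [h.rule t, Instance.ruleJob, Ne, pick_eq_none (base_pos hμ)]
    exact Finset.ne_empty_of_mem (Instance.mem_pendingSet.2 hq₀)
  obtain ⟨q, hq⟩ := Option.ne_none_iff_exists'.1 hne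
  refine ⟨q, hq, ?_⟩
  rw [h.rule t] at hq
  obtain ⟨_, i, h1, h2, h3, h4⟩ := eligible_of_pick hq
  simp only [Instance.mem_pendingSet] at h1 h3 h4
  refine ⟨i, h1, ?_, h3, h4⟩
  have e : ∀ j, σ.classWeight μ j t = ∑ m ∈ I.pendingSet σ.job t with I.densityClass μ m = j,
      base μ ^ I.weightClass μ m := by
    intro j
    unfold Schedule.classWeight Instance.pendingSet Instance.roundedWeight
    rw [Finset.filter_filter]
  simpa only [e] using h2

/-- Processed times are not part of the view but are determined by the past schedule. At the infimum
of the disagreement times the pasts coincide, hence so do the selections, and right constancy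
extends the agreement past the infimum. -/
theorem job_eq_of_sameView (h : σ.IsRuleRun μ) (h' : σ'.IsRuleRun μ) {t : ℝ}
    (hv : SameView σ σ' t) : σ.job t = σ'.job t := by
  obtain ⟨hv₁, hv₂, hv₃⟩ := hv
  by_contra hne
  set B : Set ℝ := {s | s ≤ t ∧ σ.job s ≠ σ'.job s} with hB
  have hBne : B.Nonempty := ⟨t, le_rfl, hne⟩
  have hBbd : BddBelow B := by
    refine ⟨0, fun s hs => ?_⟩
    by_contra! hs0
    refine hs.2 ?_
    have : ∀ {I : Instance} (σ : Schedule I), σ.job s = none := by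
      intro I σ
      rw [Option.eq_none_iff_forall_ne_some]
      intro q hq
      have := σ.job_pending s q hq
      exact absurd (I.release_nonneg q this.1) (this.2.1.trans_lt hs0).not_ge
    rw [this σ, this σ']
  set x := sInf B with hx
  have hxt : x ≤ t := csInf_le hBbd ⟨le_rfl, hne⟩
  have hbefore : ∀ s, s < x → σ.job s = σ'.job s := by
    intro s hs
    by_contra hs'
    exact absurd (csInf_le hBbd ⟨hs.le.trans hxt, hs'⟩) hs.not_ge
  have hat : σ.job x = σ'.job x := by
    rw [h.rule x, h'.rule x]
    unfold Instance.ruleJob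
    have hP : I.pendingSet σ.job x = I'.pendingSet σ'.job x := by
      ext q
      rw [Instance.mem_pendingSet, Instance.mem_pendingSet]
      exact hv₃ x hxt q
    rw [← hP]
    have hagree : ∀ m ∈ I.pendingSet σ.job x,
        I.weight m = I'.weight m ∧ I.pred m = I'.pred m := by
      intro m hm
      rw [Instance.mem_pendingSet] at hm
      exact (hv₂ m hm.1 (hm.2.1.trans hxt)).2
    have hw : ∀ m ∈ I.pendingSet σ.job x, I.weightClass μ m = I'.weightClass μ m := by
      intro m hm
      unfold Instance.weightClass
      rw [(hagree m hm).1]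
    refine pick_congr hw ?_ ?_
    · intro m hm
      unfold Instance.densityClass Instance.roundedWeight
      rw [hw m hm, (hagree m hm).2]
    · intro m _
      rw [Set.mem_ofPred_eq, Set.mem_ofPred_eq, processed_congr fun s _ hs => hbefore s hs]
  obtain ⟨ε, hε, hc⟩ := h.rightConstant x
  obtain ⟨δ, hδ, hc'⟩ := h'.rightConstant x
  obtain ⟨s, hs, hsx⟩ := exists_lt_of_csInf_lt hBne
    (show sInf B < x + min ε δ by rw [← hx]; linarith [lt_min hε hδ])
  have hxs : x ≤ s := csInf_le hBbd hs
  refine hs.2 ?_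
  rw [hc s hxs (by linarith [min_le_left ε δ]), hc' s hxs (by linarith [min_le_right ε δ]), hat]

/-- There is at most one partially processed pending job in each pair of classes. -/
theorem eq_of_touched (h : σ.IsRuleRun μ) {t : ℝ} {q q' : ℕ}
    (hq : I.Pending σ.job q t) (hq' : I.Pending σ.job q' t)
    (hd : I.densityClass μ q = I.densityClass μ q') (hw : I.weightClass μ q = I.weightClass μ q')
    (ht : 0 < processed σ.job q t) (ht' : 0 < processed σ.job q' t) : q = q' := by
  have start : ∀ q, 0 < processed σ.job q t → ∃ x, x < t ∧ processed σ.job q x = 0 ∧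
      σ.job x = some q ∧ ∀ s, x < s → 0 < processed σ.job q s := by
    intro q hq
    -- The supremum of `Z` is the moment at which `q` is started; right constancy puts `q` on the
    -- machine at that very moment.
    set Z : Set ℝ := {s | processed σ.job q s = 0} with hZ
    have hZne : Z.Nonempty := ⟨0, processed_of_nonpos le_rfl⟩
    have hZub : ∀ s ∈ Z, s ≤ t := by
      intro s hs
      by_contra! hlt
      have := processed_mono σ.job q hlt.le
      rw [show processed σ.job q s = 0 from hs] at this
      linarith
    have hZbd : BddAbove Z := ⟨t, hZub⟩
    have hZc : IsClosed Z :=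
      isClosed_eq (continuous_processed (σ.measurable_job q)) continuous_const
    have hx : sSup Z ∈ Z := hZc.csSup_mem hZne hZbd
    set x := sSup Z
    have hpos : ∀ s, x < s → 0 < processed σ.job q s := by
      intro s hs
      refine (processed_nonneg _ _ _).lt_of_ne' fun h0 => ?_
      exact absurd (le_csSup hZbd h0) hs.not_ge
    have hx0 : 0 ≤ x := le_csSup hZbd (processed_of_nonpos le_rfl)
    refine ⟨x, (hZub x hx).lt_of_ne ?_, hx, ?_, hpos⟩
    · intro hxt
      rw [← hxt] at hq
      exact hq.ne' hx
    · obtain ⟨ε, hε, hc⟩ := h.rightConstant x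
      by_contra hne
      have := processed_eq_of_forall_ne (σ.measurable_job q) hx0
        (show x ≤ x + ε by linarith) fun u hu hu' => by rw [hc u hu.le hu']; exact hne
      have h2 := hpos (x + ε) (by linarith)
      rw [this, show processed σ.job q x = 0 from hx] at h2
      exact lt_irrefl _ h2
  -- Of two jobs in the same classes, the later cannot be started while the earlier is started and
  -- still pending.
  have main : ∀ q q', I.Pending σ.job q t → I.Pending σ.job q' t →
      I.densityClass μ q = I.densityClass μ q' → I.weightClass μ q = I.weightClass μ q' →
      ∀ x x', σ.job x' = some q' → processed σ.job q' x' = 0 →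
      (∀ s, x < s → 0 < processed σ.job q s) → x < x' → x' < t → False := by
    intro q q' hq hq' hd hw x x' hj h0 hp hlt hx't
    have hj' := hj
    rw [h.rule x'] at hj'
    obtain ⟨_, i, _, _, _, h4⟩ := eligible_of_pick hj'
    have h5 := h4 ⟨q, Instance.mem_pendingSet.2 ⟨hq.1, ?_, ?_⟩, hd, hw, hp x' hlt⟩
    · rw [Set.mem_ofPred_eq, h0] at h5
      exact lt_irrefl _ h5
    · by_contra! hr
      have := hp x' hlt
      rw [σ.processed_of_le_release hr.le] at this
      exact lt_irrefl _ this
    · exact (processed_mono σ.job q hx't.le).trans_lt hq.2.2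
  obtain ⟨x, hxt, hx0, hxj, hxp⟩ := start q ht
  obtain ⟨x', hxt', hx0', hxj', hxp'⟩ := start q' ht'
  rcases lt_trichotomy x x' with hlt | heq | hlt
  · exact (main q q' hq hq' hd hw x x' hxj' hx0' hxp hlt hxt').elim
  · rw [← heq, hxj] at hxj'
    exact Option.some_injective _ hxj'
  · exact (main q' q hq' hq hd.symm hw.symm x' x hxj hx0 hxp' hlt hxt).elim

end Schedule.IsRuleRun

/-- Distinct powers form a geometric series dominated by the largest. Applied to started jobs, whose
weight classes are distinct within a density class, it bounds their total weight. -/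
theorem sum_zpow_le {b : ℝ} (hb : 1 < b) (S : Finset ℤ) {K : ℤ} (hS : ∀ k ∈ S, k ≤ K) :
    (b - 1) * ∑ k ∈ S, b ^ k ≤ b ^ (K + 1) := by
  induction S using Finset.induction_on_max generalizing K with
  | empty =>
    rw [Finset.sum_empty, mul_zero]
    exact (zpow_pos (by linarith) _).le
  | insert a s hlt ih =>
    rw [Finset.sum_insert fun h => lt_irrefl a (hlt a h)]
    have h1 := ih (K := a - 1) fun k hk => by have := hlt k hk; omega
    rw [sub_add_cancel] at h1
    have h2 : b ^ (a + 1) ≤ b ^ (K + 1) :=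
      zpow_le_zpow_right₀ hb.le (by have := hS a (Finset.mem_insert_self a s); omega)
    rw [zpow_add_one₀ (by linarith)] at h2
    linarith

theorem twentyTwo_lt_base {μ : ℝ} (hμ : 1 < μ) : 22 < base μ := by unfold base; linarith

/-! ### Rounding errors of the weight and density classes -/

section Classes

variable {I : Instance} {μ : ℝ} {q : ℕ}

theorem roundedWeight_pos (hμ : 1 < μ) (q : ℕ) : 0 < I.roundedWeight μ q :=
  zpow_pos (base_pos hμ) _

theorem zpow_floor_logb_le {b x : ℝ} (hb : 1 < b) (hx : 0 < x) : b ^ ⌊Real.logb b x⌋ ≤ x := by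
  rw [← Real.rpow_intCast]
  calc b ^ ((⌊Real.logb b x⌋ : ℤ) : ℝ) ≤ b ^ Real.logb b x :=
        Real.rpow_le_rpow_of_exponent_le hb.le (Int.floor_le _)
    _ = x := Real.rpow_logb (by linarith) hb.ne' hx

theorem lt_zpow_floor_logb_add_one {b x : ℝ} (hb : 1 < b) (hx : 0 < x) :
    x < b ^ (⌊Real.logb b x⌋ + 1) := by
  rw [← Real.rpow_intCast]
  calc x = b ^ Real.logb b x := (Real.rpow_logb (by linarith) hb.ne' hx).symm
    _ < b ^ (((⌊Real.logb b x⌋ + 1 : ℤ)) : ℝ) := by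
        refine Real.rpow_lt_rpow_of_exponent_lt hb ?_
        push_cast
        exact Int.lt_floor_add_one _

theorem weight_le_roundedWeight (hμ : 1 < μ) (hq : q ∈ I.jobs) :
    I.weight q ≤ I.roundedWeight μ q := by
  have hb : 1 < base μ := by linarith [twentyTwo_lt_base hμ]
  unfold Instance.roundedWeight Instance.weightClass
  rw [← Real.rpow_intCast]
  calc I.weight q = base μ ^ Real.logb (base μ) (I.weight q) :=
        (Real.rpow_logb (by linarith) hb.ne' (I.weight_pos q hq)).symm
    _ ≤ _ := Real.rpow_le_rpow_of_exponent_le hb.le (Int.le_ceil _)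

theorem roundedWeight_le (hμ : 1 < μ) (hq : q ∈ I.jobs) :
    I.roundedWeight μ q ≤ base μ * I.weight q := by
  have hb : 1 < base μ := by linarith [twentyTwo_lt_base hμ]
  unfold Instance.roundedWeight Instance.weightClass
  rw [← Real.rpow_intCast]
  calc base μ ^ ((⌈Real.logb (base μ) (I.weight q)⌉ : ℤ) : ℝ)
      ≤ base μ ^ (1 + Real.logb (base μ) (I.weight q)) := by
        refine Real.rpow_le_rpow_of_exponent_le hb.le ?_
        linarith [Int.ceil_lt_add_one (Real.logb (base μ) (I.weight q))]
    _ = _ := by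
        rw [Real.rpow_add (by linarith), Real.rpow_one,
          Real.rpow_logb (by linarith) hb.ne' (I.weight_pos q hq)]

theorem zpow_densityClass_mul_le (hμ : 1 < μ) (hq : q ∈ I.jobs) :
    2 ^ I.densityClass μ q * I.roundedWeight μ q ≤ I.pred q := by
  have hw := roundedWeight_pos (I := I) hμ q
  rw [← le_div_iff₀ hw]
  exact zpow_floor_logb_le one_lt_two (div_pos (I.pred_pos q hq) hw)

theorem pred_lt (hμ : 1 < μ) (hq : q ∈ I.jobs) :
    I.pred q < 2 * 2 ^ I.densityClass μ q * I.roundedWeight μ q := by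
  have hw := roundedWeight_pos (I := I) hμ q
  have := lt_zpow_floor_logb_add_one one_lt_two (div_pos (I.pred_pos q hq) hw)
  rw [div_lt_iff₀ hw, zpow_add_one₀ two_ne_zero] at this
  unfold Instance.densityClass
  linarith

theorem procTime_le (hμ : 1 < μ) (hD : I.DistortionBelow μ) (hq : q ∈ I.jobs) :
    I.procTime q ≤ 2 * μ * (2 ^ I.densityClass μ q * I.roundedWeight μ q) := by
  have h1 := (hD q hq).2
  have h2 := pred_lt hμ hq
  nlinarith

end Classes

namespace Instance

open Classical in
/-- The jobs of density class at most `j`, and those of weight class at least `h`. -/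
noncomputable def lowOrHeavy (I : Instance) (μ : ℝ) (h j : ℤ) : Finset ℕ :=
  I.jobs.filter fun q => I.densityClass μ q ≤ j ∨ h ≤ I.weightClass μ q

/-- The rounded weight of the jobs pending at time `t`. -/
noncomputable def pendingWeight (I : Instance) (μ : ℝ) (job : ℝ → Option ℕ) (t : ℝ) : ℝ :=
  ∑ q ∈ I.pendingSet job t, I.roundedWeight μ q

end Instance

/-- How much less `σ` has processed the jobs in `S` than `τ` by time `t`. -/
noncomputable def deficit {I : Instance} (σ τ : Schedule I) (S : Finset ℕ) (t : ℝ) : ℝ :=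
  ∑ q ∈ S, (processed τ.job q t - processed σ.job q t)

/-! ### The lag of the rule behind another schedule -/

section Analysis

variable {I : Instance} {σ τ : Schedule I} {μ : ℝ} {s t x : ℝ} {h j : ℤ} {q : ℕ}

theorem not_pending_iff (σ : Schedule I) (hq : q ∈ I.jobs) :
    ¬ I.Pending σ.job q t ↔ t < I.release q ∨ processed σ.job q t = I.procTime q := by
  unfold Instance.Pending
  have := σ.processed_le hq t
  constructor
  · intro hn
    by_contra! hc
    exact hn ⟨hq, hc.1, this.lt_of_ne hc.2⟩
  · rintro (h1 | h1) ⟨_, h2, h3⟩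
    · exact absurd h1 h2.not_gt
    · exact h3.ne h1

/-- After `x` the machine of `σ` works on `S` without pause, and `τ` cannot gain on it. The loss `x
- s` covers the case that the last moment outside `S` is only approached. -/
theorem deficit_le_add (S : Finset ℕ) (hs : 0 ≤ s) (hsx : s ≤ x) (hxt : x ≤ t)
    (hS : ∀ u, x < u → u < t → ∃ q ∈ S, σ.job u = some q) :
    deficit σ τ S t ≤ deficit σ τ S s + (x - s) := by
  have h1 := sum_processed_sub_le τ.measurable_job S hs (hsx.trans hxt)
  have h2 := le_sum_processed_sub σ.measurable_job (hs.trans hsx) hxt hS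
  have h3 : ∑ q ∈ S, processed σ.job q s ≤ ∑ q ∈ S, processed σ.job q x :=
    Finset.sum_le_sum fun q _ => processed_mono _ _ hsx
  unfold deficit
  rw [Finset.sum_sub_distrib] at h1 h2
  rw [Finset.sum_sub_distrib, Finset.sum_sub_distrib]
  linarith

theorem sum_eq_sum_ite_of_subset {S A : Finset ℕ} (hA : A ⊆ S) (f : ℕ → ℝ) :
    ∑ q ∈ A, f q = ∑ q ∈ S, if q ∈ A then f q else 0 := by
  rw [Finset.sum_ite_mem, Finset.inter_eq_right.2 hA]

/-- If no heavy job is pending, the deficit is at most the volume of the pending jobs. -/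
theorem deficit_le_of_no_heavy (hh : ∀ q, I.Pending σ.job q s → I.weightClass μ q < h) :
    deficit σ τ (I.lowOrHeavy μ h j) s ≤
      ∑ q ∈ I.pendingSet σ.job s with I.densityClass μ q ≤ j, I.procTime q := by
  classical
  have hsub : (I.pendingSet σ.job s).filter (fun q => I.densityClass μ q ≤ j) ⊆
      I.lowOrHeavy μ h j := by
    intro q hq
    rw [Finset.mem_filter, Instance.mem_pendingSet] at hq
    exact Finset.mem_filter.2 ⟨hq.1.1, Or.inl hq.2⟩
  rw [sum_eq_sum_ite_of_subset hsub]
  refine Finset.sum_le_sum fun q hq => ?_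
  obtain ⟨hqI, hq⟩ := Finset.mem_filter.1 hq
  have h1 := processed_nonneg σ.job q s
  have h2 := τ.processed_le hqI s
  simp only [Finset.mem_filter, Instance.mem_pendingSet]
  by_cases hp : I.Pending σ.job q s
  · rw [if_pos ⟨hp, hq.resolve_right (hh q hp).not_ge⟩]
    linarith
  · rw [if_neg fun hc => hp hc.1]
    rcases (not_pending_iff σ hqI).1 hp with h3 | h3
    · rw [σ.processed_of_le_release h3.le, τ.processed_of_le_release h3.le, sub_zero]
    · linarith

/-- The remaining volume of released jobs is bounded by the remaining volume in `τ` and the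
deficit, provided that `τ` has completed the heavy jobs. -/
theorem sum_remaining_le (hh : ∀ q, I.Pending τ.job q t → I.weightClass μ q < h) {A : Finset ℕ}
    (hA : ∀ q ∈ A, q ∈ I.jobs ∧ I.release q ≤ t ∧ I.densityClass μ q ≤ j) :
    ∑ q ∈ A, (I.procTime q - processed σ.job q t) ≤
      (∑ q ∈ I.pendingSet τ.job t with I.densityClass μ q ≤ j, I.procTime q) +
        deficit σ τ (I.lowOrHeavy μ h j) t := by
  classical
  have hsub : (I.pendingSet τ.job t).filter (fun q => I.densityClass μ q ≤ j) ⊆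
      I.lowOrHeavy μ h j := by
    intro q hq
    rw [Finset.mem_filter, Instance.mem_pendingSet] at hq
    exact Finset.mem_filter.2 ⟨hq.1.1, Or.inl hq.2⟩
  have hsub' : A ⊆ I.lowOrHeavy μ h j := fun q hq =>
    Finset.mem_filter.2 ⟨(hA q hq).1, Or.inl (hA q hq).2.2⟩
  rw [sum_eq_sum_ite_of_subset hsub, sum_eq_sum_ite_of_subset hsub', deficit,
    ← Finset.sum_add_distrib]
  refine Finset.sum_le_sum fun q hq => ?_
  obtain ⟨hqI, hq⟩ := Finset.mem_filter.1 hq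
  have h1 := processed_nonneg τ.job q t
  have h2 := σ.processed_le hqI t
  simp only [Finset.mem_filter, Instance.mem_pendingSet]
  by_cases hp : I.Pending τ.job q t
  · rw [if_pos (c := I.Pending τ.job q t ∧ _) ⟨hp, hq.resolve_right (hh q hp).not_ge⟩]
    split_ifs <;> linarith
  · rw [if_neg (c := I.Pending τ.job q t ∧ _) fun hc => hp hc.1, zero_add]
    rcases (not_pending_iff τ hqI).1 hp with h3 | h3
    · rw [if_neg fun hc => absurd h3 (hA q hc).2.1.not_gt,
        σ.processed_of_le_release h3.le, τ.processed_of_le_release h3.le, sub_zero]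
    · split_ifs <;> linarith

theorem sum_procTime_le (hμ : 1 < μ) (hD : I.DistortionBelow μ) (job : ℝ → Option ℕ) (t : ℝ)
    (j : ℤ) :
    ∑ q ∈ I.pendingSet job t with I.densityClass μ q ≤ j, I.procTime q ≤
      2 * μ * 2 ^ j * I.pendingWeight μ job t := by
  classical
  unfold Instance.pendingWeight
  rw [Finset.mul_sum]
  refine (Finset.sum_le_sum fun q hq => ?_).trans (Finset.sum_le_sum_of_subset_of_nonneg
    (Finset.filter_subset _ _) fun q _ _ => ?_)
  · rw [Finset.mem_filter, Instance.mem_pendingSet] at hq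
    refine (procTime_le hμ hD hq.1.1).trans ?_
    rw [mul_assoc (2 * μ)]
    refine mul_le_mul_of_nonneg_left ?_ (by linarith)
    exact mul_le_mul_of_nonneg_right (zpow_le_zpow_right₀ one_le_two hq.2)
      (roundedWeight_pos hμ q).le
  · have := roundedWeight_pos (I := I) hμ q
    positivity

/-- If `σ` processes a job of density class above `j`, then the pending jobs of density class at
most `j` have small volume. -/
theorem Schedule.IsRuleRun.volume_le (hσ : σ.IsRuleRun μ) (hμ : 1 < μ) (hD : I.DistortionBelow μ)
    (hq : σ.job s = some q) (hj : j < I.densityClass μ q) :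
    ∃ m, I.Pending σ.job m s ∧ j < I.densityClass μ m ∧
      ∑ q ∈ I.pendingSet σ.job s with I.densityClass μ q ≤ j, I.procTime q ≤
        4 * μ * 2 ^ j * I.roundedWeight μ m := by
  classical
  rw [hσ.rule s] at hq
  obtain ⟨_, i, ⟨⟨m, hmP, hmi⟩, _⟩, ⟨_, hleast⟩, _, _⟩ := eligible_of_pick hq
  have hb := base_pos hμ
  -- The witness is a heaviest pending job: its own weight already qualifies its density class,
  -- which is therefore at least the class selected.
  refine ⟨m, Instance.mem_pendingSet.1 hmP, hj.trans_le (hleast ?_), ?_⟩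
  · rw [Set.mem_ofPred_eq, ← hmi]
    exact Finset.single_le_sum (f := fun m => base μ ^ I.weightClass μ m)
      (fun m _ => (zpow_pos hb _).le) (Finset.mem_filter.2 ⟨hmP, rfl⟩)
  · set A := (I.pendingSet σ.job s).filter fun q => I.densityClass μ q ≤ j with hA
    rw [← Finset.sum_fiberwise_of_maps_to (g := I.densityClass μ) (t := A.image (I.densityClass μ))
      fun q hq => Finset.mem_image_of_mem _ hq]
    have hjle : ∀ k ∈ A.image (I.densityClass μ), k ≤ j := by
      intro k hk
      obtain ⟨q, hq, rfl⟩ := Finset.mem_image.1 hk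
      exact (Finset.mem_filter.1 hq).2
    have hclass : ∀ k ∈ A.image (I.densityClass μ),
        ∑ q ∈ A with I.densityClass μ q = k, I.procTime q ≤
          2 * μ * I.roundedWeight μ m * 2 ^ k := by
      intro k hk
      have hlt : ∑ m ∈ I.pendingSet σ.job s with I.densityClass μ m = k,
          base μ ^ I.weightClass μ m < base μ ^ i := by
        by_contra! hc
        exact absurd (hleast hc) ((hjle k hk).trans_lt hj).not_ge
      rw [← hmi] at hlt
      calc ∑ q ∈ A with I.densityClass μ q = k, I.procTime q
          ≤ ∑ q ∈ A with I.densityClass μ q = k, 2 * μ * 2 ^ k * I.roundedWeight μ q := by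
            refine Finset.sum_le_sum fun q hq => ?_
            rw [Finset.mem_filter, hA, Finset.mem_filter, Instance.mem_pendingSet] at hq
            have := procTime_le hμ hD hq.1.1.1
            rw [hq.2] at this
            linarith
        _ ≤ ∑ q ∈ I.pendingSet σ.job s with I.densityClass μ q = k,
              2 * μ * 2 ^ k * I.roundedWeight μ q := by
            refine Finset.sum_le_sum_of_subset_of_nonneg
              (Finset.filter_subset_filter _ (Finset.filter_subset _ _)) fun q _ _ => ?_
            have := roundedWeight_pos (I := I) hμ q
            positivity
        _ ≤ 2 * μ * 2 ^ k * I.roundedWeight μ m := by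
            rw [← Finset.mul_sum]
            exact mul_le_mul_of_nonneg_left hlt.le (by positivity)
        _ = _ := by ring
    refine (Finset.sum_le_sum hclass).trans ?_
    rw [← Finset.mul_sum]
    have hgeo := sum_zpow_le (b := (2 : ℝ)) one_lt_two _ hjle
    rw [zpow_add_one₀ two_ne_zero] at hgeo
    have hw := roundedWeight_pos (I := I) hμ m
    have h2 : 0 < 2 * μ * I.roundedWeight μ m := by positivity
    nlinarith [mul_le_mul_of_nonneg_left hgeo h2.le]

/-- If light jobs are processed while a heavy one is pending, then most of the weight of their
density class is unprocessed. -/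
theorem Schedule.IsRuleRun.le_untouched_volume (hσ : σ.IsRuleRun μ) (hμ : 1 < μ)
    (hD : I.DistortionBelow μ) (hq : σ.job s = some q) (hlight : I.weightClass μ q < h)
    (hheavy : ∃ m, I.Pending σ.job m s ∧ h ≤ I.weightClass μ m) :
    ∃ U : Finset ℕ, (∀ m ∈ U, I.Pending σ.job m s ∧ I.densityClass μ m = I.densityClass μ q ∧
        I.weightClass μ m < h ∧ processed σ.job m s = 0) ∧
      20 / 21 * (2 ^ I.densityClass μ q * base μ ^ h) ≤ ∑ m ∈ U, I.procTime m := by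
  classical
  rw [hσ.rule s] at hq
  obtain ⟨_, i, ⟨_, hmax⟩, ⟨hweight, _⟩, ⟨_, hgr⟩, _⟩ := eligible_of_pick hq
  have hb := base_pos hμ
  have hb' := twentyTwo_lt_base hμ
  obtain ⟨m₀, hm₀, hm₀h⟩ := hheavy
  have hhi : h ≤ i := hm₀h.trans (hmax ⟨m₀, Instance.mem_pendingSet.2 hm₀, rfl⟩)
  set B := (I.pendingSet σ.job s).filter fun m => I.densityClass μ m = I.densityClass μ q with hB
  have hBmem : ∀ m ∈ B, I.Pending σ.job m s ∧ I.densityClass μ m = I.densityClass μ q ∧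
      I.weightClass μ m < h := by
    intro m hm
    have hm' := Finset.mem_filter.1 hm
    exact ⟨Instance.mem_pendingSet.1 hm'.1, hm'.2, (hgr ⟨m, hm'.1, hm'.2, rfl⟩).trans_lt hlight⟩
  have hBw : base μ ^ h ≤ ∑ m ∈ B, I.roundedWeight μ m :=
    (zpow_le_zpow_right₀ (by linarith) hhi).trans hweight
  refine ⟨B.filter fun m => processed σ.job m s = 0, ?_, ?_⟩
  · intro m hm
    rw [Finset.mem_filter] at hm
    obtain ⟨h1, h2, h3⟩ := hBmem m hm.1
    exact ⟨h1, h2, h3, hm.2⟩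
  set T := B.filter fun m => ¬ processed σ.job m s = 0 with hT
  -- Started jobs of one density class have distinct weight classes, all below `h`, so they weigh at
  -- most λ^h/(λ-1) ≤ λ^h/21.
  have hinj : Set.InjOn (I.weightClass μ) T := by
    intro m hm m' hm' hmm
    rw [Finset.mem_coe, hT, Finset.mem_filter] at hm hm'
    obtain ⟨h1, h2, _⟩ := hBmem m hm.1
    obtain ⟨h1', h2', _⟩ := hBmem m' hm'.1
    exact hσ.eq_of_touched h1 h1' (h2.trans h2'.symm) hmm
      ((processed_nonneg _ _ _).lt_of_ne' hm.2) ((processed_nonneg _ _ _).lt_of_ne' hm'.2)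
  have hTw : (base μ - 1) * ∑ m ∈ T, I.roundedWeight μ m ≤ base μ ^ h := by
    have := sum_zpow_le (b := base μ) (by linarith) (T.image (I.weightClass μ)) (K := h - 1) (by
      intro k hk
      obtain ⟨m, hm, rfl⟩ := Finset.mem_image.1 hk
      have := (hBmem m (Finset.mem_filter.1 hm).1).2.2
      omega)
    rwa [Finset.sum_image hinj, sub_add_cancel] at this
  have hsplit := Finset.sum_filter_add_sum_filter_not B (fun m => processed σ.job m s = 0)
    (I.roundedWeight μ)
  rw [← hT] at hsplit
  have hTn : 0 ≤ ∑ m ∈ T, I.roundedWeight μ m :=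
    Finset.sum_nonneg fun m _ => (roundedWeight_pos hμ m).le
  have hU : 20 / 21 * base μ ^ h ≤
      ∑ m ∈ B with processed σ.job m s = 0, I.roundedWeight μ m := by
    nlinarith
  calc 20 / 21 * (2 ^ I.densityClass μ q * base μ ^ h)
      = 2 ^ I.densityClass μ q * (20 / 21 * base μ ^ h) := by ring
    _ ≤ 2 ^ I.densityClass μ q *
        ∑ m ∈ B with processed σ.job m s = 0, I.roundedWeight μ m :=
        mul_le_mul_of_nonneg_left hU (by positivity)
    _ ≤ _ := by
        rw [Finset.mul_sum]
        refine Finset.sum_le_sum fun m hm => ?_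
        obtain ⟨h1, h2, _⟩ := hBmem m (Finset.mem_filter.1 hm).1
        rw [← h2]
        exact (zpow_densityClass_mul_le hμ h1.1).trans (hD m h1.1).1

/-- If `τ` has little weight pending, then it has no heavy job pending. -/
theorem weightClass_lt_of_pendingWeight_lt (hμ : 1 < μ)
    (hW : 100 * μ * I.pendingWeight μ τ.job t < base μ ^ h) (hq : I.Pending τ.job q t) :
    I.weightClass μ q < h := by
  by_contra! hc
  have h1 : base μ ^ h ≤ I.roundedWeight μ q :=
    zpow_le_zpow_right₀ (by linarith [twentyTwo_lt_base hμ]) hc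
  have h2 : I.roundedWeight μ q ≤ I.pendingWeight μ τ.job t :=
    Finset.single_le_sum (f := I.roundedWeight μ) (fun m _ => (roundedWeight_pos hμ m).le)
      (Instance.mem_pendingSet.2 hq)
  have h3 := roundedWeight_pos (I := I) hμ q
  nlinarith

theorem deficit_zero (S : Finset ℕ) : deficit σ τ S 0 = 0 := by
  simp [deficit, processed_of_nonpos le_rfl]

/-- The bound on the deficit. -/
noncomputable def deficitBound (μ pm : ℝ) (h j : ℤ) : ℝ :=
  4 * μ * 2 ^ j * min (base μ ^ (h - 1)) (pm / 2 ^ (j + 1))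

/-- The induction step: the bound for the classes above `j` is used only to exclude that a light job
outside S_j is run while a heavy one is pending. -/
theorem deficit_le_of_deficit_le (hσ : σ.IsRuleRun μ) (hμ : 1 < μ) (hD : I.DistortionBelow μ)
    (ht : 0 ≤ t) (hW : 100 * μ * I.pendingWeight μ τ.job t < base μ ^ h)
    {pm : ℝ} (hpm₀ : 0 ≤ pm) (hpm : ∀ q ∈ I.jobs, I.procTime q ≤ pm)
    (ih : ∀ q ∈ I.jobs, j < I.densityClass μ q →
      deficit σ τ (I.lowOrHeavy μ h (I.densityClass μ q)) t ≤
        deficitBound μ pm h (I.densityClass μ q)) :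
    deficit σ τ (I.lowOrHeavy μ h j) t ≤ deficitBound μ pm h j := by
  classical
  have hb := base_pos hμ
  have hbn : 0 ≤ deficitBound μ pm h j := by
    have := zpow_pos hb (h - 1)
    unfold deficitBound
    positivity
  have hτ : ∀ q, I.Pending τ.job q t → I.weightClass μ q < h :=
    fun q hq => weightClass_lt_of_pendingWeight_lt hμ hW hq
  set S := I.lowOrHeavy μ h j with hS
  set E : Set ℝ := {s | 0 ≤ s ∧ s < t ∧ ¬ ∃ q ∈ S, σ.job s = some q} with hE
  rcases E.eq_empty_or_nonempty with hEe | hEn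
  · have := deficit_le_add (σ := σ) (τ := τ) S le_rfl le_rfl ht fun u hu hut => by
      by_contra hc
      have : u ∈ E := ⟨hu.le, hut, hc⟩
      rw [hEe] at this
      exact this
    rw [deficit_zero] at this
    linarith
  have hEbd : BddAbove E := ⟨t, fun s hs => hs.2.1.le⟩
  set x := sSup E with hx
  have hxt : x ≤ t := csSup_le hEn fun s hs => hs.2.1.le
  have hafter : ∀ u, x < u → u < t → ∃ q ∈ S, σ.job u = some q := by
    intro u hu hut
    by_contra hc
    have hx0 : 0 ≤ x := by
      obtain ⟨s, hs⟩ := hEn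
      exact hs.1.trans (le_csSup hEbd hs)
    exact absurd (le_csSup hEbd ⟨hx0.trans hu.le, hut, hc⟩) hu.not_ge
  refine le_of_forall_pos_le_add fun ε₀ hε₀ => ?_
  -- The supremum of `E` need not belong to `E`, so `s` is taken within `ε` of it. The bound by half
  -- of 2^j λ^h leaves room for the contradiction below.
  have hX : 0 < (2 : ℝ) ^ j * base μ ^ h := mul_pos (by positivity) (zpow_pos hb h)
  obtain ⟨ε, hε, hεε₀, hεX⟩ : ∃ ε > 0, ε ≤ ε₀ ∧ ε ≤ 2 ^ j * base μ ^ h / 2 :=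
    ⟨min ε₀ (2 ^ j * base μ ^ h / 2), lt_min hε₀ (by linarith), min_le_left _ _, min_le_right _ _⟩
  obtain ⟨s, hsE, hsx'⟩ := exists_lt_of_lt_csSup hEn (show x - ε < sSup E by rw [← hx]; linarith)
  have hsx : s ≤ x := le_csSup hEbd hsE
  have hadd := deficit_le_add (σ := σ) (τ := τ) S hsE.1 hsx hxt hafter
  suffices hsuff : deficit σ τ S s ≤ deficitBound μ pm h j by linarith
  obtain ⟨hs0, hst, hsS⟩ := hsE
  rcases hjob : σ.job s with _ | q
  · have hP : I.pendingSet σ.job s = ∅ := by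
      rw [hσ.rule s] at hjob
      exact (pick_eq_none hb).1 hjob
    have := deficit_le_of_no_heavy (σ := σ) (τ := τ) (s := s) (h := h) (j := j) (μ := μ)
      fun q hq => by
        rw [← Instance.mem_pendingSet, hP] at hq
        simp at hq
    rw [hP, Finset.filter_empty, Finset.sum_empty] at this
    exact this.trans hbn
  have hqI := (σ.job_pending s q hjob).1
  obtain ⟨hqj, hqh⟩ : j < I.densityClass μ q ∧ I.weightClass μ q < h := by
    have : q ∉ S := fun hq => hsS ⟨q, hq, hjob⟩
    rw [hS, Instance.lowOrHeavy, Finset.mem_filter] at this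
    push Not at this
    exact this hqI
  by_cases hheavy : ∃ m, I.Pending σ.job m s ∧ h ≤ I.weightClass μ m
  · exfalso
    obtain ⟨U, hU, hUv⟩ := hσ.le_untouched_volume hμ hD hjob hqh hheavy
    -- The jobs in `U` are light and of class above `j`, so after `x` none of them runs.
    have hUt : ∑ m ∈ U, processed σ.job m t ≤ x - s := by
      have h1 := sum_processed_sub_le σ.measurable_job U hs0 hsx
      refine le_trans (Finset.sum_le_sum fun m hm => ?_) h1
      obtain ⟨_, h3, h4, h5⟩ := hU m hm
      rw [h5, sub_zero]
      refine (processed_eq_of_forall_ne (σ.measurable_job m) (hs0.trans hsx) hxt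
        fun u hu hut hum => ?_).le
      obtain ⟨q', hq', hj'⟩ := hafter u hu hut
      rw [hum] at hj'
      obtain rfl := Option.some_injective _ hj'
      rcases (Finset.mem_filter.1 hq').2 with h6 | h6
      · rw [h3] at h6
        exact absurd hqj h6.not_gt
      · exact absurd h4 h6.not_gt
    have hrem := sum_remaining_le (σ := σ) (τ := τ) (j := I.densityClass μ q) hτ (A := U)
      fun m hm => ⟨(hU m hm).1.1, (hU m hm).1.2.1.trans hst.le, (hU m hm).2.1.le⟩
    rw [Finset.sum_sub_distrib] at hrem
    have hopt := sum_procTime_le hμ hD τ.job t (I.densityClass μ q)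
    have hd := ih q hqI hqj
    have hd2 : deficitBound μ pm h (I.densityClass μ q) ≤
        2 ^ I.densityClass μ q * base μ ^ h / 4 := by
      have h1 : deficitBound μ pm h (I.densityClass μ q) ≤
          4 * μ * 2 ^ I.densityClass μ q * base μ ^ (h - 1) :=
        mul_le_mul_of_nonneg_left (min_le_left _ _) (by positivity)
      have h2 : base μ ^ h = base μ ^ (h - 1) * base μ := by
        rw [← zpow_add_one₀ hb.ne', sub_add_cancel]
      -- The term 16μ of λ serves here: the lag bound 4μ 2^j' λ^(h-1) becomes at most a quarter of
      -- 2^j' λ^h.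
      have h3 : 16 * μ ≤ base μ := by unfold base; linarith
      have h4 : 0 < 2 ^ I.densityClass μ q * base μ ^ (h - 1) :=
        mul_pos (by positivity) (zpow_pos hb _)
      rw [h2]
      nlinarith
    have hXX : (2 : ℝ) ^ j * base μ ^ h ≤ 2 ^ I.densityClass μ q * base μ ^ h :=
      mul_le_mul_of_nonneg_right (zpow_le_zpow_right₀ one_le_two hqj.le) (zpow_pos hb h).le
    have hopt2 : 2 * μ * 2 ^ I.densityClass μ q * I.pendingWeight μ τ.job t ≤
        2 ^ I.densityClass μ q * base μ ^ h / 50 := by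
      have : (0 : ℝ) < 2 ^ I.densityClass μ q := by positivity
      nlinarith
    -- In units of 2^j' λ^h, with j' the class of `q`: at least 20/21 was untouched, but at most
    -- 1/50 (left in `τ`) + 1/4 (lag) + 1/2 (work between `s` and `x`) is available.
    linarith
  · push Not at hheavy
    obtain ⟨m, hm, hmj, hv⟩ := hσ.volume_le hμ hD hjob hqj
    refine (deficit_le_of_no_heavy hheavy).trans (hv.trans ?_)
    refine mul_le_mul_of_nonneg_left (le_min ?_ ?_) (by positivity)
    · exact zpow_le_zpow_right₀ (by linarith [twentyTwo_lt_base hμ])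
        (by have := hheavy m hm; omega)
    · rw [le_div_iff₀ (by positivity), mul_comm]
      have h1 := (zpow_densityClass_mul_le hμ hm.1).trans ((hD m hm.1).1.trans (hpm m hm.1))
      refine le_trans (mul_le_mul_of_nonneg_right ?_ (roundedWeight_pos hμ m).le) h1
      exact zpow_le_zpow_right₀ one_le_two hmj

theorem deficit_le (hσ : σ.IsRuleRun μ) (hμ : 1 < μ) (hD : I.DistortionBelow μ)
    (ht : 0 ≤ t) (hW : 100 * μ * I.pendingWeight μ τ.job t < base μ ^ h)
    {pm : ℝ} (hpm₀ : 0 ≤ pm) (hpm : ∀ q ∈ I.jobs, I.procTime q ≤ pm) (j : ℤ) :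
    deficit σ τ (I.lowOrHeavy μ h j) t ≤ deficitBound μ pm h j := by
  obtain ⟨J, hJ⟩ := (I.jobs.image (I.densityClass μ)).exists_le
  have hJ' : ∀ q ∈ I.jobs, I.densityClass μ q ≤ J := fun q hq =>
    hJ _ (Finset.mem_image_of_mem _ hq)
  -- Downward induction from the largest density class `J`; at or above `J` there is no higher class
  -- to consider.
  have key : ∀ n : ℕ, ∀ j, J - j ≤ n →
      deficit σ τ (I.lowOrHeavy μ h j) t ≤ deficitBound μ pm h j := by
    intro n
    induction n with
    | zero =>
      intro j hj
      refine deficit_le_of_deficit_le hσ hμ hD ht hW hpm₀ hpm fun q hq hjq => ?_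
      have := hJ' q hq
      omega
    | succ n ih =>
      intro j hj
      refine deficit_le_of_deficit_le hσ hμ hD ht hW hpm₀ hpm fun q hq hjq => ih _ ?_
      omega
  exact key (J - j).toNat j (Int.self_le_toNat _)

/-- If `τ` has little weight pending, then `σ` has no heavy job pending. -/
theorem weightClass_lt (hσ : σ.IsRuleRun μ) (hμ : 1 < μ) (hD : I.DistortionBelow μ)
    (ht : 0 ≤ t) (hW : 100 * μ * I.pendingWeight μ τ.job t < base μ ^ h)
    (hq : I.Pending σ.job q t) : I.weightClass μ q < h := by
  by_contra! hc
  obtain ⟨pm, hpm⟩ := (I.jobs.image I.procTime).exists_le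
  have hpm' : ∀ q ∈ I.jobs, I.procTime q ≤ pm := fun q hq => hpm _ (Finset.mem_image_of_mem _ hq)
  obtain ⟨J, hJ⟩ := (I.jobs.image (I.densityClass μ)).bddBelow
  have hτ : ∀ q, I.Pending τ.job q t → I.weightClass μ q < h :=
    fun q hq => weightClass_lt_of_pendingWeight_lt hμ hW hq
  set M := base μ ^ (h - 1)
  have hM : 0 < 4 * μ * M := by
    have : 0 < M := zpow_pos (base_pos hμ) _
    positivity
  have hδ : 0 < I.procTime q - processed σ.job q t := sub_pos.2 hq.2.2
  obtain ⟨n, hn⟩ := exists_pow_lt_of_lt_one (div_pos hδ hM) (show (1 / 2 : ℝ) < 1 by norm_num)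
  -- Below `J` the set S_j contains heavy jobs only, and below `-n` the lag bound is smaller than
  -- the remaining work of `q`.
  set j := min (J - 1) (-n : ℤ) with hj
  have hd := deficit_le hσ hμ hD ht hW (le_trans (I.procTime_pos q hq.1).le (hpm' q hq.1)) hpm' j
  have h1 : deficitBound μ pm h j ≤ 4 * μ * M * 2 ^ j := by
    calc deficitBound μ pm h j ≤ 4 * μ * 2 ^ j * M :=
          mul_le_mul_of_nonneg_left (min_le_left _ _) (by positivity)
      _ = _ := by ring
  have h2 : (2 : ℝ) ^ j ≤ (1 / 2) ^ n := by
    calc (2 : ℝ) ^ j ≤ 2 ^ (-n : ℤ) := zpow_le_zpow_right₀ one_le_two (min_le_right _ _)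
      _ = _ := by rw [zpow_neg, zpow_natCast, one_div, inv_pow]
  rw [lt_div_iff₀ hM] at hn
  have h3 : I.procTime q - processed σ.job q t ≤ deficit σ τ (I.lowOrHeavy μ h j) t := by
    have hfin : ∀ m ∈ I.lowOrHeavy μ h j, h ≤ I.weightClass μ m := by
      intro m hm
      obtain ⟨hmI, hm⟩ := Finset.mem_filter.1 hm
      refine hm.resolve_left fun hle => ?_
      have := hJ (Finset.mem_coe.2 (Finset.mem_image_of_mem _ hmI))
      omega
    have hτq : processed τ.job q t = I.procTime q :=
      ((not_pending_iff τ hq.1).1 fun hp => absurd (hτ q hp) hc.not_gt).resolve_left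
        hq.2.1.not_gt
    rw [← hτq]
    -- No summand is negative, since each heavy job is either unreleased or completed in `τ`.
    refine Finset.single_le_sum (f := fun q => processed τ.job q t - processed σ.job q t)
      (fun m hm => ?_) (Finset.mem_filter.2 ⟨hq.1, Or.inr hc⟩)
    have hmI := (Finset.mem_filter.1 hm).1
    rcases (not_pending_iff τ hmI).1 fun hp => absurd (hτ m hp) (hfin m hm).not_gt with h4 | h4
    · simp [σ.processed_of_le_release h4.le, τ.processed_of_le_release h4.le]
    · simpa [h4] using σ.processed_le hmI t
  nlinarith

end Analysis

theorem sum_two_zpow_neg_le (J : Finset ℤ) {c : ℤ} (hJ : ∀ j ∈ J, c ≤ j) :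
    ∑ j ∈ J, (2 : ℝ) ^ (-j) ≤ 2 * 2 ^ (-c) := by
  have h := sum_zpow_le (b := (2 : ℝ)) one_lt_two (J.image fun j => -j) (K := -c) (by
    intro k hk
    obtain ⟨j, hj, rfl⟩ := Finset.mem_image.1 hk
    exact neg_le_neg (hJ j hj))
  rw [Finset.sum_image fun a _ b _ hab => neg_injective hab, zpow_add_one₀ two_ne_zero] at h
  linarith

/-- Only logarithmically many terms of `∑ min M (p / 2 ^ j)` are large. -/
theorem sum_min_le {M p a : ℝ} (hM : 0 < M) (ha : 0 < a) (hap : a * M ≤ p)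
    (J : Finset ℤ) (hJ : ∀ j ∈ J, a < 2 ^ (j + 1)) :
    ∑ j ∈ J, min M (p / 2 ^ j) ≤ M * (Real.logb 2 (p / (a * M)) + 4) := by
  have hp : 0 < p := (mul_pos ha hM).trans_le hap
  set b := p / M with hb
  have hb0 : 0 < b := div_pos hp hM
  -- Up to `F` each term is bounded by `M` and the terms are counted; beyond `F` the terms p/2^j
  -- decay geometrically.
  set F := ⌊Real.logb 2 b⌋ with hF
  set G := ⌊Real.logb 2 a⌋ with hG
  have hlog : Real.logb 2 (p / (a * M)) = Real.logb 2 b - Real.logb 2 a := by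
    rw [← Real.logb_div hb0.ne' ha.ne', hb, div_div, mul_comm M a]
  have hlog0 : Real.logb 2 a ≤ Real.logb 2 b :=
    Real.logb_le_logb_of_le one_lt_two ha ((le_div_iff₀ hM).2 hap)
  have h1 : ∑ j ∈ J with j ≤ F, min M (p / 2 ^ j) ≤
      M * (Real.logb 2 b - Real.logb 2 a + 2) := by
    have hsub : J.filter (fun j => j ≤ F) ⊆ Finset.Icc G F := by
      intro j hj
      rw [Finset.mem_filter] at hj
      rw [Finset.mem_Icc]
      refine ⟨?_, hj.2⟩
      have h2 : (2 : ℝ) ^ G < 2 ^ (j + 1) :=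
        (zpow_floor_logb_le one_lt_two ha).trans_lt (hJ j hj.1)
      have := (zpow_lt_zpow_iff_right₀ one_lt_two).1 h2
      omega
    have hcard : ((J.filter fun j => j ≤ F).card : ℝ) ≤ Real.logb 2 b - Real.logb 2 a + 2 := by
      have h2 : ((J.filter fun j => j ≤ F).card : ℤ) ≤ (F + 1 - G).toNat := by
        rw [← Int.card_Icc]
        exact_mod_cast Finset.card_le_card hsub
      have h3 : ((J.filter fun j => j ≤ F).card : ℤ) ≤ max (F + 1 - G) 0 := by omega
      have h4 : ((J.filter fun j => j ≤ F).card : ℝ) ≤ max ((F : ℝ) + 1 - G) 0 := by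
        exact_mod_cast h3
      have h5 := Int.floor_le (Real.logb 2 b)
      have h6 := Int.lt_floor_add_one (Real.logb 2 a)
      refine h4.trans (max_le ?_ ?_) <;> linarith
    calc ∑ j ∈ J with j ≤ F, min M (p / 2 ^ j) ≤ ∑ j ∈ J with j ≤ F, M :=
          Finset.sum_le_sum fun j _ => min_le_left _ _
      _ = (J.filter fun j => j ≤ F).card * M := by rw [Finset.sum_const, nsmul_eq_mul]
      _ ≤ _ := by rw [mul_comm]; exact mul_le_mul_of_nonneg_left hcard hM.le
  have h2 : ∑ j ∈ J with ¬ j ≤ F, min M (p / 2 ^ j) ≤ M * 2 := by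
    calc ∑ j ∈ J with ¬ j ≤ F, min M (p / 2 ^ j) ≤ ∑ j ∈ J with ¬ j ≤ F, p * 2 ^ (-j) :=
          Finset.sum_le_sum fun j _ => (min_le_right _ _).trans_eq (by
            rw [zpow_neg, div_eq_mul_inv])
      _ ≤ p * (2 * 2 ^ (-(F + 1))) := by
          rw [← Finset.mul_sum]
          refine mul_le_mul_of_nonneg_left (sum_two_zpow_neg_le _ fun j hj => ?_) hp.le
          have := (Finset.mem_filter.1 hj).2
          omega
      _ = p / 2 ^ (F + 1) * 2 := by rw [zpow_neg]; ring
      _ ≤ M * 2 := by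
          have h3 := lt_zpow_floor_logb_add_one one_lt_two hb0
          rw [← hF, hb, div_lt_iff₀ hM] at h3
          refine mul_le_mul_of_nonneg_right ?_ zero_le_two
          rw [div_le_iff₀ (by positivity)]
          linarith
  rw [← Finset.sum_filter_add_sum_filter_not J fun j => j ≤ F, hlog]
  linarith

/-! ### Comparison of the pending weights at a fixed time -/

section LocalCompetitiveness

variable {I : Instance} {σ τ : Schedule I} {μ t : ℝ} {h : ℤ}

theorem pendingWeight_nonneg (hμ : 1 < μ) (job : ℝ → Option ℕ) (t : ℝ) :
    0 ≤ I.pendingWeight μ job t :=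
  Finset.sum_nonneg fun q _ => (roundedWeight_pos hμ q).le

theorem roundedWeight_le_min (hμ : 1 < μ) (hD : I.DistortionBelow μ) {pm : ℝ}
    (hpm : ∀ q ∈ I.jobs, I.procTime q ≤ pm) {q : ℕ} (hq : q ∈ I.jobs)
    (hh : I.weightClass μ q < h) :
    I.roundedWeight μ q ≤ min (base μ ^ (h - 1)) (pm / 2 ^ I.densityClass μ q) := by
  refine le_min (zpow_le_zpow_right₀ (by linarith [twentyTwo_lt_base hμ]) (by omega)) ?_
  rw [le_div_iff₀ (by positivity), mul_comm]
  exact (zpow_densityClass_mul_le hμ hq).trans ((hD q hq).1.trans (hpm q hq))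

/-- The partially processed jobs of one density class have small weight. -/
theorem touched_weight_le (hσ : σ.IsRuleRun μ) (hμ : 1 < μ) (hD : I.DistortionBelow μ)
    {pm : ℝ} (hpm₀ : 0 ≤ pm) (hpm : ∀ q ∈ I.jobs, I.procTime q ≤ pm)
    (hh : ∀ q, I.Pending σ.job q t → I.weightClass μ q < h) {j : ℤ} {T : Finset ℕ}
    (hT : ∀ q ∈ T, I.Pending σ.job q t ∧ 0 < processed σ.job q t ∧ I.densityClass μ q = j) :
    ∑ q ∈ T, I.roundedWeight μ q ≤ 2 * min (base μ ^ (h - 1)) (pm / 2 ^ j) := by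
  have hb := twentyTwo_lt_base hμ
  rcases T.eq_empty_or_nonempty with rfl | hne
  · have := zpow_pos (base_pos hμ) (h - 1)
    rw [Finset.sum_empty]
    positivity
  obtain ⟨m, hm, hmax⟩ := T.exists_max_image (I.weightClass μ) hne
  have hinj : Set.InjOn (I.weightClass μ) T := by
    intro q hq q' hq' hw
    obtain ⟨h1, h2, h3⟩ := hT q hq
    obtain ⟨h1', h2', h3'⟩ := hT q' hq'
    exact hσ.eq_of_touched h1 h1' (h3.trans h3'.symm) hw h2 h2'
  have hgeo := sum_zpow_le (b := base μ) (by linarith) (T.image (I.weightClass μ))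
    (K := I.weightClass μ m) (by
      intro k hk
      obtain ⟨q, hq, rfl⟩ := Finset.mem_image.1 hk
      exact hmax q hq)
  rw [Finset.sum_image hinj, zpow_add_one₀ (by linarith)] at hgeo
  obtain ⟨h1, _, h3⟩ := hT m hm
  have hle := roundedWeight_le_min hμ hD hpm h1.1 (hh m h1)
  rw [h3] at hle
  have hmp : 0 < base μ ^ I.weightClass μ m := roundedWeight_pos hμ m
  have : ∑ q ∈ T, base μ ^ I.weightClass μ q ≤ 2 * base μ ^ I.weightClass μ m := by
    by_contra! hc
    nlinarith
  calc ∑ q ∈ T, I.roundedWeight μ q ≤ 2 * I.roundedWeight μ m := this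
    _ ≤ _ := mul_le_mul_of_nonneg_left hle zero_le_two

/-- The unprocessed jobs of one density class have weight bounded through their volume. -/
theorem untouched_weight_le (hσ : σ.IsRuleRun μ) (hμ : 1 < μ) (hD : I.DistortionBelow μ)
    (ht : 0 ≤ t) (hW : 100 * μ * I.pendingWeight μ τ.job t < base μ ^ h)
    {pm : ℝ} (hpm₀ : 0 ≤ pm) (hpm : ∀ q ∈ I.jobs, I.procTime q ≤ pm) {j : ℤ} {U : Finset ℕ}
    (hU : ∀ q ∈ U, I.Pending σ.job q t ∧ processed σ.job q t = 0 ∧ I.densityClass μ q = j) :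
    ∑ q ∈ U, I.roundedWeight μ q ≤
      (∑ q ∈ I.pendingSet τ.job t with I.densityClass μ q ≤ j, I.procTime q * 2 ^ (-j)) +
        4 * μ * min (base μ ^ (h - 1)) (pm / 2 ^ j) := by
  have hrem := sum_remaining_le (σ := σ) (τ := τ) (j := j) (μ := μ) (h := h) (t := t)
    (fun q hq => weightClass_lt_of_pendingWeight_lt hμ hW hq) (A := U)
    fun q hq => ⟨(hU q hq).1.1, (hU q hq).1.2.1, (hU q hq).2.2.le⟩
  have hd := deficit_le hσ hμ hD ht hW hpm₀ hpm j
  have hj : (0 : ℝ) < 2 ^ j := by positivity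
  have h1 : 2 ^ j * ∑ q ∈ U, I.roundedWeight μ q ≤
      ∑ q ∈ U, (I.procTime q - processed σ.job q t) := by
    rw [Finset.mul_sum]
    refine Finset.sum_le_sum fun q hq => ?_
    obtain ⟨h1, h2, h3⟩ := hU q hq
    rw [h2, sub_zero, ← h3]
    exact (zpow_densityClass_mul_le hμ h1.1).trans (hD q h1.1).1
  have h2 : deficitBound μ pm h j ≤
      2 ^ j * (4 * μ * min (base μ ^ (h - 1)) (pm / 2 ^ j)) := by
    unfold deficitBound
    have : min (base μ ^ (h - 1)) (pm / 2 ^ (j + 1)) ≤ min (base μ ^ (h - 1)) (pm / 2 ^ j) :=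
      min_le_min le_rfl (div_le_div_of_nonneg_left hpm₀ hj
        (zpow_le_zpow_right₀ one_le_two (by omega)))
    calc _ ≤ 4 * μ * 2 ^ j * min (base μ ^ (h - 1)) (pm / 2 ^ j) :=
          mul_le_mul_of_nonneg_left this (by positivity)
      _ = _ := by ring
  refine le_of_mul_le_mul_left ?_ hj
  rw [mul_add, ← Finset.sum_mul, zpow_neg,
    mul_comm _ ((2 : ℝ) ^ j)⁻¹, mul_inv_cancel_left₀ hj.ne']
  linarith

theorem pendingWeight_le_of_lt (hσ : σ.IsRuleRun μ) (hμ : 1 < μ) (hD : I.DistortionBelow μ)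
    (ht : 0 ≤ t) (hW : 100 * μ * I.pendingWeight μ τ.job t < base μ ^ h)
    {pn pm : ℝ} (hpn₀ : 0 < pn) (hpn : ∀ q ∈ I.jobs, pn ≤ I.procTime q) (hnm : pn ≤ pm)
    (hpm : ∀ q ∈ I.jobs, I.procTime q ≤ pm) :
    I.pendingWeight μ σ.job t ≤ 4 * μ * I.pendingWeight μ τ.job t +
      (4 * μ + 2) * (base μ ^ (h - 1) * (Real.logb 2 (μ * (pm / pn)) + 4)) := by
  classical
  have hpm₀ : 0 ≤ pm := hpn₀.le.trans hnm
  set M := base μ ^ (h - 1) with hMdef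
  have hM : 0 < M := zpow_pos (base_pos hμ) _
  have hh : ∀ q, I.Pending σ.job q t → I.weightClass μ q < h :=
    fun q hq => weightClass_lt hσ hμ hD ht hW hq
  set P := I.pendingSet σ.job t with hP
  set J := P.image (I.densityClass μ) with hJ
  have hclass : ∀ j ∈ J, ∑ q ∈ P with I.densityClass μ q = j, I.roundedWeight μ q ≤
      (∑ q ∈ I.pendingSet τ.job t with I.densityClass μ q ≤ j, I.procTime q * 2 ^ (-j)) +
        (4 * μ + 2) * min M (pm / 2 ^ j) := by
    intro j _
    rw [← Finset.sum_filter_add_sum_filter_not _ (fun q => processed σ.job q t = 0)]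
    have h1 := untouched_weight_le hσ hμ hD ht hW hpm₀ hpm (j := j)
      (U := (P.filter fun q => I.densityClass μ q = j).filter fun q => processed σ.job q t = 0)
      fun q hq => by
        simp only [Finset.mem_filter, hP, Instance.mem_pendingSet] at hq
        exact ⟨hq.1.1, hq.2, hq.1.2⟩
    have h2 := touched_weight_le hσ hμ hD hpm₀ hpm hh (j := j)
      (T := (P.filter fun q => I.densityClass μ q = j).filter fun q => ¬ processed σ.job q t = 0)
      fun q hq => by
        simp only [Finset.mem_filter, hP, Instance.mem_pendingSet] at hq
        exact ⟨hq.1.1, (processed_nonneg _ _ _).lt_of_ne' hq.2, hq.1.2⟩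
    linarith
  have hopt : ∑ j ∈ J, ∑ q ∈ I.pendingSet τ.job t with I.densityClass μ q ≤ j,
      I.procTime q * 2 ^ (-j) ≤ 4 * μ * I.pendingWeight μ τ.job t := by
    -- After exchanging the sums, each job pending in `τ` contributes a geometric series starting at
    -- its own density class.
    simp only [Finset.sum_filter]
    rw [Finset.sum_comm, Instance.pendingWeight, Finset.mul_sum]
    refine Finset.sum_le_sum fun q hq => ?_
    rw [← Finset.sum_filter, ← Finset.mul_sum]
    have hqI := (Instance.mem_pendingSet.1 hq).1
    have h1 := sum_two_zpow_neg_le (J.filter fun j => I.densityClass μ q ≤ j)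
      (c := I.densityClass μ q) fun j hj => (Finset.mem_filter.1 hj).2
    have h2 := procTime_le hμ hD hqI
    have hd : (0 : ℝ) < 2 ^ I.densityClass μ q := by positivity
    calc _ ≤ I.procTime q * (2 * 2 ^ (-I.densityClass μ q)) :=
          mul_le_mul_of_nonneg_left h1 (I.procTime_pos q hqI).le
      _ ≤ 2 * μ * (2 ^ I.densityClass μ q * I.roundedWeight μ q) *
          (2 * 2 ^ (-I.densityClass μ q)) :=
          mul_le_mul_of_nonneg_right h2 (by positivity)
      _ = _ := by rw [zpow_neg]; field_simp; ring
  -- A job pending in `σ` has rounded weight at most `M` and length at least `pn`, which forces pn <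
  -- 2μM·2^j for its density class j; this is the lower cutoff `a`.
  have hmin := sum_min_le (M := M) (p := pm) (a := pn / (μ * M)) hM (by positivity) (by
      rw [div_mul_eq_mul_div, mul_div_mul_right _ _ hM.ne', div_le_iff₀ (by linarith)]
      nlinarith) J (by
      intro j hj
      obtain ⟨q, hq, rfl⟩ := Finset.mem_image.1 hj
      rw [hP, Instance.mem_pendingSet] at hq
      have h1 := (min_le_left _ _).trans' (roundedWeight_le_min hμ hD hpm hq.1 (hh q hq))
      have h3 := (hD q hq.1).2
      have h4 := pred_lt hμ hq.1
      have h5 := hpn q hq.1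
      rw [div_lt_iff₀ (by positivity), zpow_add_one₀ two_ne_zero]
      have hd : (0 : ℝ) < 2 ^ I.densityClass μ q := by positivity
      calc pn ≤ I.procTime q := h5
        _ < μ * I.pred q := h3
        _ ≤ μ * (2 * 2 ^ I.densityClass μ q * M) := by
          refine mul_le_mul_of_nonneg_left (h4.le.trans ?_) (by linarith)
          exact mul_le_mul_of_nonneg_left h1 (by positivity)
        _ = _ := by ring)
  have hlog : pm / (pn / (μ * M) * M) = μ * (pm / pn) := by
    field_simp
  rw [hlog] at hmin
  calc I.pendingWeight μ σ.job t
      = ∑ j ∈ J, ∑ q ∈ P with I.densityClass μ q = j, I.roundedWeight μ q :=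
        (Finset.sum_fiberwise_of_maps_to (fun q hq => Finset.mem_image_of_mem _ hq) _).symm
    _ ≤ _ := Finset.sum_le_sum hclass
    _ = _ := Finset.sum_add_distrib
    _ ≤ _ := by
      rw [← Finset.mul_sum]
      exact add_le_add hopt (mul_le_mul_of_nonneg_left hmin (by linarith))

theorem one_le_procRatio (I : Instance) : 1 ≤ I.procRatio := by
  unfold Instance.procRatio
  split_ifs with hne
  · obtain ⟨q, hq⟩ := hne
    have hpos : 0 < I.jobs.inf' ⟨q, hq⟩ I.procTime :=
      (Finset.lt_inf'_iff _).2 fun m hm => I.procTime_pos m hm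
    rw [one_le_div hpos]
    exact (Finset.inf'_le _ hq).trans (Finset.le_sup' _ hq)
  · exact le_rfl

theorem pendingWeight_le (hσ : σ.IsRuleRun μ) (hμ : 1 < μ) (hD : I.DistortionBelow μ)
    (ht : 0 ≤ t) :
    I.pendingWeight μ σ.job t ≤
      2404 * μ ^ 2 * (1 + Real.logb 2 (μ * I.procRatio)) * I.pendingWeight μ τ.job t := by
  have hb := twentyTwo_lt_base hμ
  set W := I.pendingWeight μ τ.job t with hWdef
  have hW0 : 0 ≤ W := pendingWeight_nonneg hμ τ.job t
  rcases hW0.eq_or_lt with h0 | hpos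
  · have hP : I.pendingSet σ.job t = ∅ := by
      rw [Finset.eq_empty_iff_forall_notMem]
      intro q hq
      -- If nothing is pending in `τ`, every `h` is admissible, in particular the weight class of
      -- `q` itself.
      refine lt_irrefl (I.weightClass μ q) (weightClass_lt (τ := τ) hσ hμ hD ht ?_
        (Instance.mem_pendingSet.1 hq))
      rw [← hWdef, ← h0, mul_zero]
      exact zpow_pos (base_pos hμ) _
    rw [Instance.pendingWeight, hP, Finset.sum_empty, ← h0, mul_zero]
  · have hX : 0 < 100 * μ * W := by positivity
    have hne : I.jobs.Nonempty := by
      by_contra hne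
      rw [Finset.not_nonempty_iff_eq_empty] at hne
      simp [hWdef, Instance.pendingWeight, Instance.pendingSet, hne] at hpos
    have hinf : 0 < I.jobs.inf' hne I.procTime :=
      (Finset.lt_inf'_iff _).2 fun m hm => I.procTime_pos m hm
    have hle := pendingWeight_le_of_lt hσ hμ hD ht
      -- This is the least `h` with 100μW < λ^h, so that λ^(h-1) ≤ 100μW.
      (h := ⌊Real.logb (base μ) (100 * μ * W)⌋ + 1) (pm := I.jobs.sup' hne I.procTime)
      (lt_zpow_floor_logb_add_one (by linarith) hX) hinf
      (fun q hq => Finset.inf'_le _ hq)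
      (hne.elim fun q hq => (Finset.inf'_le _ hq).trans (Finset.le_sup' _ hq))
      (fun q hq => Finset.le_sup' _ hq)
    have hratio : I.procRatio = I.jobs.sup' hne I.procTime / I.jobs.inf' hne I.procTime := by
      unfold Instance.procRatio
      rw [dif_pos hne]
    rw [← hratio, add_sub_cancel_right, ← hWdef] at hle
    have hM := zpow_floor_logb_le (b := base μ) (by linarith) hX
    have hL : 0 ≤ Real.logb 2 (μ * I.procRatio) :=
      Real.logb_nonneg one_lt_two (by nlinarith [one_le_procRatio I])
    set L := Real.logb 2 (μ * I.procRatio)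
    have h1 : base μ ^ ⌊Real.logb (base μ) (100 * μ * W)⌋ * (L + 4) ≤
        100 * μ * W * (4 * (1 + L)) :=
      mul_le_mul hM (by linarith) (by linarith) hX.le
    calc _ ≤ 4 * μ * W + (4 * μ + 2) * (100 * μ * W * (4 * (1 + L))) :=
          hle.trans (by gcongr)
      _ ≤ 4 * μ ^ 2 * (1 + L) * W + 6 * μ * (100 * μ * W * (4 * (1 + L))) := by
          refine add_le_add (mul_le_mul_of_nonneg_right ?_ hpos.le)
            (mul_le_mul_of_nonneg_right (by linarith) (by positivity))
          nlinarith [mul_nonneg (sq_nonneg μ) hL]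
      _ = _ := by ring

theorem sum_weight_le (hσ : σ.IsRuleRun μ) (hμ : 1 < μ) (hD : I.DistortionBelow μ) (t : ℝ) :
    ∑ q ∈ I.pendingSet σ.job t, I.weight q ≤
      60000 * μ ^ 3 * (1 + Real.logb 2 (μ * I.procRatio)) *
        ∑ q ∈ I.pendingSet τ.job t, I.weight q := by
  have hL : 0 ≤ Real.logb 2 (μ * I.procRatio) :=
    Real.logb_nonneg one_lt_two (by nlinarith [one_le_procRatio I])
  set L := Real.logb 2 (μ * I.procRatio)
  have hwn : 0 ≤ ∑ q ∈ I.pendingSet τ.job t, I.weight q :=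
    Finset.sum_nonneg fun q hq => (I.weight_pos q (Instance.mem_pendingSet.1 hq).1).le
  rcases lt_or_ge t 0 with ht | ht
  · have hP : I.pendingSet σ.job t = ∅ := by
      rw [Finset.eq_empty_iff_forall_notMem]
      intro q hq
      rw [Instance.mem_pendingSet] at hq
      exact absurd (I.release_nonneg q hq.1) (hq.2.1.trans_lt ht).not_ge
    rw [hP, Finset.sum_empty]
    positivity
  have hτ : I.pendingWeight μ τ.job t ≤ 22 * μ * ∑ q ∈ I.pendingSet τ.job t, I.weight q := by
    rw [Finset.mul_sum]
    refine Finset.sum_le_sum fun q hq => ?_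
    have hqI := (Instance.mem_pendingSet.1 hq).1
    refine (roundedWeight_le hμ hqI).trans (mul_le_mul_of_nonneg_right ?_ (I.weight_pos q hqI).le)
    unfold base
    linarith
  calc ∑ q ∈ I.pendingSet σ.job t, I.weight q ≤ I.pendingWeight μ σ.job t :=
        Finset.sum_le_sum fun q hq =>
          weight_le_roundedWeight hμ (Instance.mem_pendingSet.1 hq).1
    _ ≤ 2404 * μ ^ 2 * (1 + L) * I.pendingWeight μ τ.job t := pendingWeight_le hσ hμ hD ht
    _ ≤ 2404 * μ ^ 2 * (1 + L) * (22 * μ * ∑ q ∈ I.pendingSet τ.job t, I.weight q) :=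
        mul_le_mul_of_nonneg_left hτ (by positivity)
    _ = 52888 * (μ ^ 3 * (1 + L) * ∑ q ∈ I.pendingSet τ.job t, I.weight q) := by ring
    _ ≤ 60000 * (μ ^ 3 * (1 + L) * ∑ q ∈ I.pendingSet τ.job t, I.weight q) :=
        mul_le_mul_of_nonneg_right (by norm_num) (by positivity)
    _ = _ := by ring

end LocalCompetitiveness

/-! ### Flow time as the integral of the pending weight -/

section FlowTime

variable {I : Instance} (σ : Schedule I)

theorem measurableSet_pending (q : ℕ) : MeasurableSet {t | I.Pending σ.job q t} := by
  unfold Instance.Pending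
  exact (MeasurableSet.const _).inter (measurableSet_Ici.inter
    (measurableSet_lt (continuous_processed (σ.measurable_job q)).measurable measurable_const))

/-- A job is pending exactly from its release until its completion. A job that is never completed is
pending on a half-line, in agreement with completion time `⊤`. -/
theorem volume_pending {q : ℕ} (hq : q ∈ I.jobs) :
    volume {t | I.Pending σ.job q t} =
      σ.completionTime q - ENNReal.ofReal (I.release q) := by
  have hr := I.release_nonneg q hq
  unfold Schedule.completionTime
  set C : Set ℝ := {t : ℝ | 0 ≤ t ∧ I.procTime q ≤ processed σ.job q t} with hC
  rcases C.eq_empty_or_nonempty with hCe | hCn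
  · have : {t | I.Pending σ.job q t} = Set.Ici (I.release q) := by
      ext t
      refine ⟨fun h => h.2.1, fun h => ⟨hq, h, ?_⟩⟩
      by_contra! hc
      have : t ∈ C := ⟨hr.trans h, hc⟩
      rw [hCe] at this
      exact this
    rw [this, hCe]
    simp
  · have hbd : BddBelow C := ⟨0, fun t ht => ht.1⟩
    have hcl : IsClosed C := (isClosed_le continuous_const continuous_id).inter
      (isClosed_le continuous_const (continuous_processed (σ.measurable_job q)))
    have hc : sInf C ∈ C := hcl.csInf_mem hCn hbd
    have hinf : ⨅ t ∈ C, ENNReal.ofReal t = ENNReal.ofReal (sInf C) :=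
      le_antisymm (iInf₂_le _ hc)
        (le_iInf₂ fun t ht => ENNReal.ofReal_le_ofReal (csInf_le hbd ht))
    have : {t | I.Pending σ.job q t} = Set.Ico (I.release q) (sInf C) := by
      ext t
      constructor
      · rintro ⟨_, h1, h2⟩
        refine ⟨h1, ?_⟩
        by_contra! h3
        exact absurd h2 (hc.2.trans (processed_mono _ _ h3)).not_gt
      · rintro ⟨h1, h2⟩
        refine ⟨hq, h1, ?_⟩
        by_contra! h3
        exact absurd (csInf_le hbd ⟨hr.trans h1, h3⟩) h2.not_ge
    rw [this, hinf, Real.volume_Ico, ENNReal.ofReal_sub _ hr]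

theorem flowTime_eq_lintegral :
    σ.flowTime = ∫⁻ t, ENNReal.ofReal (∑ q ∈ I.pendingSet σ.job t, I.weight q) := by
  classical
  have h1 : ∀ t, ENNReal.ofReal (∑ q ∈ I.pendingSet σ.job t, I.weight q) =
      ∑ q ∈ I.jobs, {t | I.Pending σ.job q t}.indicator
        (fun _ => ENNReal.ofReal (I.weight q)) t := by
    intro t
    rw [ENNReal.ofReal_sum_of_nonneg fun q hq =>
      (I.weight_pos q (Instance.mem_pendingSet.1 hq).1).le, Instance.pendingSet,
      Finset.sum_filter]
    refine Finset.sum_congr rfl fun q _ => ?_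
    simp only [Set.indicator_apply, Set.mem_ofPred_eq]
  simp only [h1]
  rw [lintegral_finsetSum _ fun q _ => measurable_const.indicator (measurableSet_pending σ q)]
  refine Finset.sum_congr rfl fun q hq => ?_
  rw [lintegral_indicator_const (measurableSet_pending σ q), volume_pending σ hq]

end FlowTime

theorem Schedule.IsRuleRun.flowTime_le {I : Instance} {σ : Schedule I} {μ : ℝ} (hσ : σ.IsRuleRun μ)
    (hμ : 1 < μ) (hD : I.DistortionBelow μ) :
    σ.flowTime ≤
      ENNReal.ofReal (60000 * μ ^ 3 * (1 + Real.logb 2 (μ * I.procRatio))) * I.opt := by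
  have hL : 0 ≤ Real.logb 2 (μ * I.procRatio) :=
    Real.logb_nonneg one_lt_two (by nlinarith [one_le_procRatio I])
  set ρ := 60000 * μ ^ 3 * (1 + Real.logb 2 (μ * I.procRatio)) with hρ
  have hρ0 : 0 < ρ := by positivity
  unfold Instance.opt
  rw [ENNReal.mul_iInf_of_ne (ENNReal.ofReal_pos.2 hρ0).ne' ENNReal.ofReal_ne_top]
  refine le_iInf fun τ => ?_
  rw [flowTime_eq_lintegral, flowTime_eq_lintegral,
    ← lintegral_const_mul' _ _ ENNReal.ofReal_ne_top]
  refine lintegral_mono fun t => ?_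
  rw [← ENNReal.ofReal_mul hρ0.le]
  exact ENNReal.ofReal_le_ofReal (sum_weight_le hσ hμ hD t)

end SPPT

theorem mainTheorem1 :
    ∃ C : ℝ, 0 < C ∧ ∀ μ : ℝ, 1 < μ →
      ∃ A : SPPT.OnlineAlgorithm,
        (∀ I : SPPT.Instance, (A.run I).FollowsDensityRule μ) ∧
        A.IsRobustCompetitive μ
          (fun I => C * μ ^ 3 * (1 + Real.logb 2 (μ * I.procRatio))) := by
  refine ⟨60000, by norm_num, fun μ hμ => ?_⟩
  choose run hrun using fun I => SPPT.exists_isRuleRun I hμ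
  exact ⟨⟨run, fun I I' t hv => (hrun I).job_eq_of_sameView (hrun I') hv⟩,
    fun I => (hrun I).followsDensityRule hμ, fun I hD => (hrun I).flowTime_le hμ hD⟩
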